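/- **Theorem (Second-order convergence, damped IMEX method).** \label{thm:error_damp_IMEX} Let $\mathcal V,\mathcal H,\mathcal Q$ be real Hilbert spaces, where $\mathcal V\hookrightarrow\mathcal H\cong\mathcal H^*\hookrightarrow\mathcal V^*$ is a Gelfand triple (continuous and dense embedding), and let $T>0$. Let $\mathcal A\in\mathcal L(\mathcal V,\mathcal V^*)$, $\mathcal B\in\mathcal L(\mathcal V,\mathcal Q^*)$, $\mathcal D\in\mathcal L(\mathcal H,\mathcal V^*)$ and put $\mathcal V_{\ker}=\ker\mathcal B$, $\mathcal H_{\ker}=\overline{\mathcal V_{\ker}}^{\mathcal H}$, $\mathcal V_{\mathrm c}=\{v\in\mathcal V:\langle\mathcal Av,\varphi\rangle=0\ \forall\varphi\in\mathcal V_{\ker}\}$. Assume: - $\mathcal B$ satisfies an inf-sup condition: there is $\beta>0$ with $\sup_{v\in\mathcal V\setminus\{0\}}\frac{\langle\mathcal Bv,q\rangle}{\|v\|_{\mathcal V}\|q\|_{\mathcal Q}}\ge\beta$ for all $q\in\mathcal Q\setminus\{0\}$. Then for every $q\in\mathcal Q^*$ there is a unique $\mathcal B^-q\in\mathcal V_{\mathrm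 c}$ with $\mathcal B\mathcal B^-q=q$ (using also the next assumption). - $\mathcal A$ is elliptic on $\mathcal V_{\ker}$, and $\mathcal A=\mathcal A_1+\mathcal A_2$ with $\mathcal A_1\in\mathcal L(\mathcal V,\mathcal V^*)$ self-adjoint and $\mathcal A_2\in\mathcal L(\mathcal V,\mathcal H^*)$. - $\mathcal D|_{\mathcal V}\in\mathcal L(\mathcal V,\mathcal H^*)$ and $(\mathcal Dv,v)_{\mathcal H}\ge0$ for all $v\in\mathcal V$. - $f\colon[0,T]\times\mathcal H\to\mathcal H^*$ is such that for every $\rho>0$ there is $L_{\mathcal V}(\rho)$ with $\|f(t,v_1)-f(t,v_2)\|_{\mathcal H^*}\le L_{\mathcal V}(\rho)\|v_1-v_2\|_{\mathcal V}$ for all $t\in[0,T]$ and $v_1,v_2\in\mathcal V$ with $\|v_i\|_{\mathcal V}\le\rho$. (This holds in particular if $f$ is Lipschitz in its second argument on $\mathcal H$, uniformly in $t$.) Let $(u,\lambda)\colon[0,T]\to\mathcal V\times\mathcal Q$ solve $$\ddot u+\mathcal D\dot u+\mathcal Au+\mathcal B^*\lambda=f(t,u)\ \text{ in }\mathcal V^*,\qquad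 \mathcal Bu=g\ \text{ in }\mathcal Q^*,\qquad u(0)=u^0,\ \dot u(0)=w^0,$$ with consistent initial data $u^0=u^0_{\ker}+\mathcal B^-g(0)$ and $w^0=w^0_{\ker}+\mathcal B^-\dot g(0)$, where $w^0_{\ker}\in\mathcal V_{\ker}$ and $u^0_{\ker}$ lies in the domain of $\mathcal A_{\ker}$, i.e. $u^0_{\ker}\in\mathcal V_{\ker}$ and $\mathcal Au^0_{\ker}$ restricted to $\mathcal V_{\ker}$ is represented by an element of $\mathcal H_{\ker}$. Assume $$u\in C^3([0,T],\mathcal V)\cap C^4([0,T],\mathcal H),\qquad f(\cdot,u(\cdot))\in C^2([0,T],\mathcal H),\qquad g\in C^4([0,T],\mathcal Q^*),$$ where $g$ is given as a $C^4$ function also beyond $T$, on $[0,\tfrac32T]$, since the scheme evaluates it at $T+\tau/2$. For an integer $N\ge1$ let $\tau=T/N$, $t_s=s\tau$, $g^s=g(t_s)$, and let $u^n\in\mathcal V$, $w^n\in\mathcal H$ be computed from $u^0,w^0$ by the constrained IMEX Crank–Nicolson scheme: for $0\le n<N$, with $f^n=f(t_n,u^n)$, find $(w^{n+1/2},\lambda^{n+1})\in\mathcal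 V\times\mathcal Q$ with $$\big(\mathrm{id}+\tfrac\tau2\mathcal D+\tfrac{\tau^2}4\mathcal A\big)w^{n+1/2}+\tfrac\tau2\mathcal B^*\lambda^{n+1}=w^n-\tfrac\tau2\mathcal Au^n+\tfrac\tau2f^n,\qquad \mathcal Bw^{n+1/2}=\tfrac1\tau(g^{n+1}-g^n),$$ set $u^{n+1}=u^n+\tau w^{n+1/2}$, and find $(w^{n+1},\mu^{n+1})\in(\mathcal H_{\ker}+\mathcal V_{\mathrm c})\times\mathcal Q$ with $$w^{n+1}+\mathcal B^*\mu^{n+1}=2w^{n+1/2}-w^n+\tfrac\tau2(f^{n+1}-f^n),\qquad \mathcal Bw^{n+1}=\tfrac1\tau(g^{n+3/2}-g^{n+1/2}),$$ where $\mathcal Bw=q$ for $w\in\mathcal H_{\ker}+\mathcal V_{\mathrm c}$ means that $w=h+c$ with $h\in\mathcal H_{\ker}$, $c\in\mathcal V_{\mathrm c}$, $\mathcal Bc=q$. Then there is a constant $C>0$, independent of $\tau$ and $n$, such that for all $N\ge1$ and all $0\le n\le N$ $$\|u(t_n)-u^n\|_{\mathcal V}+\|\dot u(t_n)-w^n\|_{\mathcal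 H}\le C\,\tau^2 .$$ -/

import Mathlib

open Set

noncomputable section

namespace ConstrainedWave

variable {V H Q : Type*}
  [NormedAddCommGroup V] [InnerProductSpace ℝ V]
  [NormedAddCommGroup H] [InnerProductSpace ℝ H]
  [NormedAddCommGroup Q] [InnerProductSpace ℝ Q]

/-! Conventions. All spaces are real Hilbert spaces. The dual of `V` (and of `Q`) is
`StrongDual ℝ V`; the pivot space `H` is identified with its dual by the Riesz isomorphism, so
that `h : H` acts on `φ : V` by `inner ℝ h (J φ)`, with `J : V →L[ℝ] H` the embedding.
Functions on a time interval are functions on `ℝ` that are used on this interval only. -/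

/-- `V ↪ H ↪ V*` is a Gelfand triple: `J` embeds `V` continuously and densely into `H`. -/
structure IsGelfandTriple (J : V →L[ℝ] H) : Prop where
  injective : Function.Injective J
  denseRange : DenseRange J

/-- The kernel `V_ker` of the constraint operator. -/
def kerV (B : V →L[ℝ] StrongDual ℝ Q) : Submodule ℝ V := LinearMap.ker B.toLinearMap

/-- The closure `H_ker` of `V_ker` in `H`. -/
def kerH (J : V →L[ℝ] H) (B : V →L[ℝ] StrongDual ℝ Q) : Submodule ℝ H :=
  ((kerV B).map J.toLinearMap).topologicalClosure

/-- The complement `V_c = {v | ⟨A v, φ⟩ = 0 for all φ ∈ V_ker}` of `V_ker`. -/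
def complV (A : V →L[ℝ] StrongDual ℝ V) (B : V →L[ℝ] StrongDual ℝ Q) : Submodule ℝ V where
  carrier := {v | ∀ φ ∈ kerV B, A v φ = 0}
  add_mem' := by
    intro a b ha hb φ hφ
    simp [ha φ hφ, hb φ hφ]
  zero_mem' := by
    intro φ _
    simp
  smul_mem' := by
    intro c a ha φ hφ
    simp [ha φ hφ]

/-- `v = B⁻ q` for the right-inverse `B⁻ : Q* → V` of `B` with range `V_c`. -/
def IsRightInverseValue (A : V →L[ℝ] StrongDual ℝ V) (B : V →L[ℝ] StrongDual ℝ Q)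
    (q : StrongDual ℝ Q) (v : V) : Prop :=
  v ∈ complV A B ∧ B v = q

/-- `v ∈ V_ker` lies in the domain of `A_ker`: the functional `A v`, restricted to `V_ker`, is
represented by an element of `H_ker`. -/
def MemDomainKer (J : V →L[ℝ] H) (A : V →L[ℝ] StrongDual ℝ V) (B : V →L[ℝ] StrongDual ℝ Q)
    (v : V) : Prop :=
  v ∈ kerV B ∧ ∃ h ∈ kerH J B, ∀ φ ∈ kerV B, A v φ = inner ℝ h (J φ)

/-- The constraint operator satisfies an inf-sup condition. -/
def InfSupCondition (B : V →L[ℝ] StrongDual ℝ Q) : Prop :=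
  ∃ β : ℝ, 0 < β ∧ ∀ q : Q, q ≠ 0 → β ≤ ⨆ v : {v : V // v ≠ 0}, B v.1 q / (‖v.1‖ * ‖q‖)

/-- Assumption on `A`: elliptic on `V_ker`, and `A = A₁ + A₂` with `A₁` self-adjoint and
`A₂` bounded from `V` to `H* = H`. -/
structure DifferentialAssumption (J : V →L[ℝ] H) (A : V →L[ℝ] StrongDual ℝ V)
    (B : V →L[ℝ] StrongDual ℝ Q) : Prop where
  elliptic : ∃ α : ℝ, 0 < α ∧ ∀ v ∈ kerV B, α * ‖v‖ ^ 2 ≤ A v v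
  decomposition : ∃ (A₁ : V →L[ℝ] StrongDual ℝ V) (A₂ : V →L[ℝ] H),
    (∀ v φ, A v φ = A₁ v φ + inner ℝ (A₂ v) (J φ)) ∧ ∀ v φ, A₁ v φ = A₁ φ v

/-- Assumption on `D : H → V*`: its restriction to `V` is bounded from `V` to `H* = H` and
monotone. -/
def DampingAssumption (J : V →L[ℝ] H) (D : H →L[ℝ] StrongDual ℝ V) : Prop :=
  ∃ D₀ : V →L[ℝ] H, (∀ v φ, D (J v) φ = inner ℝ (D₀ v) (J φ)) ∧
    ∀ v, 0 ≤ inner ℝ (D₀ v) (J v)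

/-- Assumption on `f : [0,T] × H → H* = H`: Lipschitz on bounded subsets of `V`, uniformly in
time, with respect to the norm of `V`. -/
def LocallyLipschitzNonlinearity (J : V →L[ℝ] H) (T : ℝ) (f : ℝ → H → H) : Prop :=
  ∀ ρ : ℝ, ∃ L : ℝ, ∀ t ∈ Icc 0 T, ∀ v₁ v₂ : V, ‖v₁‖ ≤ ρ → ‖v₂‖ ≤ ρ →
    ‖f t (J v₁) - f t (J v₂)‖ ≤ L * ‖v₁ - v₂‖

/-- The velocity `u̇`, with values in `H` and one-sided derivatives at the end points. -/
def velocity (J : V →L[ℝ] H) (T : ℝ) (u : ℝ → V) : ℝ → H :=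
  derivWithin (fun t => J (u t)) (Icc 0 T)

/-- `(u, lam)` solves `ü + D u̇ + A u + B* lam = f(t, u)` in `V*` and `B u = g` in `Q*` on
`[0,T]`, with `u(0) = u₀` and `u̇(0) = w₀`. Here `u` is twice continuously differentiable as a
function with values in `H`, so that the two time derivatives are classical. -/
structure IsSolution (J : V →L[ℝ] H) (A : V →L[ℝ] StrongDual ℝ V)
    (B : V →L[ℝ] StrongDual ℝ Q) (D : H →L[ℝ] StrongDual ℝ V)
    (f : ℝ → H → H) (g : ℝ → StrongDual ℝ Q) (T : ℝ) (u₀ w₀ : V)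
    (u : ℝ → V) (lam : ℝ → Q) : Prop where
  contDiffOn : ContDiffOn ℝ 2 (fun t => J (u t)) (Icc 0 T)
  dynamic : ∀ t ∈ Icc 0 T, ∀ φ : V,
    inner ℝ (derivWithin (velocity J T u) (Icc 0 T) t) (J φ) + D (velocity J T u t) φ
      + A (u t) φ + B φ (lam t) = inner ℝ (f t (J (u t))) (J φ)
  constraint : ∀ t ∈ Icc 0 T, B (u t) = g t
  initial_value : u 0 = u₀
  initial_velocity : velocity J T u 0 = J w₀

/-- `w ∈ H_ker + V_c ⊆ H` satisfies the constraint `B w = q`, where `B` is extended to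
`H_ker + V_c` by zero on `H_ker`. -/
def ExtendedConstraint (J : V →L[ℝ] H) (A : V →L[ℝ] StrongDual ℝ V)
    (B : V →L[ℝ] StrongDual ℝ Q) (w : H) (q : StrongDual ℝ Q) : Prop :=
  ∃ h ∈ kerH J B, ∃ c ∈ complV A B, w = h + J c ∧ B c = q

/-- One step `(uⁿ, wⁿ) ↦ (uⁿ⁺¹, wⁿ⁺¹)` of the constrained IMEX Crank–Nicolson scheme with step
size `τ`, starting at time `t = tₙ`. It consists of a saddle point problem for `(w_half, lam)`,
an update of `u`, and a saddle point problem for `(w', mu)`. -/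
structure IMEXStep (J : V →L[ℝ] H) (A : V →L[ℝ] StrongDual ℝ V)
    (B : V →L[ℝ] StrongDual ℝ Q) (D : H →L[ℝ] StrongDual ℝ V)
    (f : ℝ → H → H) (g : ℝ → StrongDual ℝ Q) (τ t : ℝ)
    (u : V) (w : H) (w_half : V) (lam : Q) (u' : V) (w' : H) (mu : Q) : Prop where
  half_step : ∀ φ : V,
    inner ℝ (J w_half) (J φ) + τ / 2 * D (J w_half) φ + τ ^ 2 / 4 * A w_half φ
        + τ / 2 * B φ lam
      = inner ℝ w (J φ) - τ / 2 * A u φ + τ / 2 * inner ℝ (f t (J u)) (J φ)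
  half_constraint : B w_half = τ⁻¹ • (g (t + τ) - g t)
  update : u' = u + τ • w_half
  full_step : ∀ φ : V,
    inner ℝ w' (J φ) + B φ mu
      = inner ℝ ((2 : ℝ) • J w_half - w
          + (τ / 2) • (f (t + τ) (J u') - f t (J u))) (J φ)
  full_constraint :
    ExtendedConstraint J A B w' (τ⁻¹ • (g (t + 3 / 2 * τ) - g (t + τ / 2)))

/-- `(U n, W n)`, `0 ≤ n ≤ N`, are approximations of `(u, u̇)` at `tₙ = n τ` computed by the
scheme. -/
structure IsIMEXSequence (J : V →L[ℝ] H) (A : V →L[ℝ] StrongDual ℝ V)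
    (B : V →L[ℝ] StrongDual ℝ Q) (D : H →L[ℝ] StrongDual ℝ V)
    (f : ℝ → H → H) (g : ℝ → StrongDual ℝ Q) (τ : ℝ) (N : ℕ) (u₀ w₀ : V)
    (U : ℕ → V) (W : ℕ → H) : Prop where
  initial_u : U 0 = u₀
  initial_w : W 0 = J w₀
  step : ∀ n < N, ∃ (w_half : V) (lam mu : Q),
    IMEXStep J A B D f g τ (n * τ) (U n) (W n) w_half lam (U (n + 1)) (W (n + 1)) mu

end ConstrainedWave

end

/-! Tested with `V_ker`, the scheme loses its multipliers: it becomes a trapezoidal rule for the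
momentum equation, together with a relation between velocities and position increments that holds
modulo the orthogonal complement of `H_ker` (`IMEXStep.tested`). Testing the error equation with the
increment `e' - e` makes the energy `‖y‖² + A₁ e e + κ ‖J e‖²` telescope; the damping has a sign,
`A₂` is of lower order, and Gårding's inequality makes the energy coercive on `V_ker`
(`ErrorStep.energy_le`, `exists_garding`).

The exact solution itself is not consistent enough. Its defect in the velocity relation is only
`O(τ²)` per step, and the trapezoidal error of `A u` is paired with `e' - e` in `V`, where no factor
`τ` is gained. Errors are therefore measured against `u + τ² a` and `u̇ + τ² b`, with `a` and `b`
cancelling the leading defects (`exists_isCorrection`). What remains is `O(τ³)` per step, Gronwall's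
inequality gives `O(τ²)`, and removing the corrections costs `O(τ²)` once.

Since `f` is only locally Lipschitz, the energy argument needs an a priori bound of `e`. The new
nonlinear term cancels from the estimate of `e' - e` (`ErrorStep.norm_increment_le`), so for small
`τ` the condition `‖e‖ ≤ 1` propagates by induction (`IsErrorSeq.exists_bound_of_small`). The other
step sizes `T / N` are finitely many, and mere boundedness suffices for them
(`IsErrorSeq.exists_bound`).

The energy sees only the projection `y` of the velocity error onto `H_ker`. The rest is dictated by
the constraint, where a central difference replaces `ġ` (`ExtendedConstraint.norm_map_sub_le`,
`IsDerivSeq.central_difference`). -/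

noncomputable section

namespace ConstrainedWave

/-! ### Saddle point structure: right inverse of `B`, projections, Gårding's inequality. -/

section FunctionalAnalysis

variable {V H Q : Type*}
  [NormedAddCommGroup V] [InnerProductSpace ℝ V]
  [NormedAddCommGroup H] [InnerProductSpace ℝ H]
  [NormedAddCommGroup Q] [InnerProductSpace ℝ Q]

/-- The inf-sup condition bounds the adjoint of `B` from below. -/
lemma InfSupCondition.le_norm_flip {B : V →L[ℝ] StrongDual ℝ Q} (hB : InfSupCondition B) :
    ∃ β : ℝ, 0 < β ∧ ∀ q : Q, β * ‖q‖ ≤ ‖B.flip q‖ := by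
  obtain ⟨β, hβ, h⟩ := hB
  refine ⟨β, hβ, fun q => ?_⟩
  rcases eq_or_ne q 0 with rfl | hq
  · simp
  have hq' : 0 < ‖q‖ := norm_pos_iff.2 hq
  rw [← le_div_iff₀ hq']
  -- Nonnegativity of the bound is needed for the case of an empty index set, where the real
  -- supremum is `0`.
  refine (h q hq).trans (Real.iSup_le (fun v => ?_) (by positivity))
  have hv : 0 < ‖v.1‖ := norm_pos_iff.2 v.2
  rw [div_le_div_iff₀ (by positivity) hq']
  have h1 : B v.1 q ≤ ‖B.flip q‖ * ‖v.1‖ := (le_abs_self _).trans ((B.flip q).le_opNorm v.1)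
  nlinarith

/-- An operator satisfying an inf-sup condition has a bounded linear right inverse. -/
lemma InfSupCondition.exists_rightInverse [CompleteSpace V] [CompleteSpace Q]
    {B : V →L[ℝ] StrongDual ℝ Q} (hB : InfSupCondition B) :
    ∃ R : StrongDual ℝ Q →L[ℝ] V, ∀ q, B (R q) = q := by
  obtain ⟨β, hβ, h⟩ := hB.le_norm_flip
  let S : Q →L[ℝ] V :=
    (InnerProductSpace.toDual ℝ V).symm.toContinuousLinearEquiv.toContinuousLinearMap ∘L B.flip
  have hS : ∀ q v, inner ℝ (S q) v = B v q := fun q v => by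
    simp [S]
  -- `B B*` is coercive on `Q`, because its quadratic form is `‖B* q‖²`. By Lax–Milgram, `B* (B
  -- B*)⁻¹` is then a right inverse.
  have hco : IsCoercive (B ∘L S) := by
    refine ⟨β ^ 2, by positivity, fun q => ?_⟩
    have h1 : (B ∘L S) q q = ‖S q‖ ^ 2 := by
      rw [← real_inner_self_eq_norm_sq, hS]; rfl
    have h2 : ‖S q‖ = ‖B.flip q‖ := by simp [S]
    rw [h1, h2]
    have := h q
    have h3 : 0 ≤ β * ‖q‖ := by positivity
    nlinarith
  let G := hco.continuousLinearEquivOfBilin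
  refine ⟨S ∘L G.symm.toContinuousLinearMap ∘L
    (InnerProductSpace.toDual ℝ Q).symm.toContinuousLinearEquiv.toContinuousLinearMap,
    fun q => ?_⟩
  ext x
  have := hco.continuousLinearEquivOfBilin_apply
    (G.symm ((InnerProductSpace.toDual ℝ Q).symm q)) x
  have h2 : hco.continuousLinearEquivOfBilin (G.symm ((InnerProductSpace.toDual ℝ Q).symm q))
    = (InnerProductSpace.toDual ℝ Q).symm q := G.apply_symm_apply _
  rw [h2, InnerProductSpace.toDual_symm_apply] at this
  exact this.symm

instance [CompleteSpace V] (B : V →L[ℝ] StrongDual ℝ Q) : CompleteSpace (kerV B) :=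
  (ContinuousLinearMap.isClosed_ker B).completeSpace_coe

/-- The bounded projection onto `V_ker` along `V_c`. -/
lemma exists_projection_kerV [CompleteSpace V]
    {A : V →L[ℝ] StrongDual ℝ V} {B : V →L[ℝ] StrongDual ℝ Q}
    (hA : ∃ α : ℝ, 0 < α ∧ ∀ v ∈ kerV B, α * ‖v‖ ^ 2 ≤ A v v) :
    ∃ P : V →L[ℝ] V, ∀ v, P v ∈ kerV B ∧ v - P v ∈ complV A B := by
  obtain ⟨α, hα, h⟩ := hA
  let i : kerV B →L[ℝ] V := (kerV B).subtypeL
  let r : V →L[ℝ] kerV B :=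
    (InnerProductSpace.toDual ℝ (kerV B)).symm.toContinuousLinearEquiv.toContinuousLinearMap ∘L
      ((ContinuousLinearMap.compL ℝ (kerV B) V ℝ).flip i) ∘L A
  have hr : ∀ v φ, inner ℝ (r v) φ = A v φ := fun v φ => by simp [r, i]
  let A' : kerV B →L[ℝ] StrongDual ℝ (kerV B) :=
    ((ContinuousLinearMap.compL ℝ (kerV B) V ℝ).flip i) ∘L A ∘L i
  -- Lax–Milgram on `V_ker`, as `A` need not be symmetric: `P v` is the solution of `A (P v) φ = A v
  -- φ` for all `φ ∈ V_ker`.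
  have hco : IsCoercive A' := by
    refine ⟨α, hα, fun v => ?_⟩
    have := h v v.2
    simp only [A', i]
    simp only [ContinuousLinearMap.comp_apply, ContinuousLinearMap.flip_apply,
      ContinuousLinearMap.compL_apply, Submodule.subtypeL_apply]
    rw [Submodule.coe_norm]
    nlinarith
  let G := hco.continuousLinearEquivOfBilin
  refine ⟨i ∘L G.symm.toContinuousLinearMap ∘L r, fun v => ⟨(G.symm (r v)).2, fun φ hφ => ?_⟩⟩
  have h1 := hco.continuousLinearEquivOfBilin_apply (G.symm (r v)) ⟨φ, hφ⟩
  have h2 : hco.continuousLinearEquivOfBilin (G.symm (r v)) = r v := G.apply_symm_apply _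
  rw [h2, hr] at h1
  have h3 : A v φ = A (G.symm (r v) : V) φ := h1
  simp [i, h3]

/-- The right inverse `B⁻` of `B` with range in `V_c`, as a bounded operator. -/
lemma exists_rightInverse_complV [CompleteSpace V] [CompleteSpace Q]
    {A : V →L[ℝ] StrongDual ℝ V} {B : V →L[ℝ] StrongDual ℝ Q} (hB : InfSupCondition B)
    (hA : ∃ α : ℝ, 0 < α ∧ ∀ v ∈ kerV B, α * ‖v‖ ^ 2 ≤ A v v) :
    ∃ R : StrongDual ℝ Q →L[ℝ] V, ∀ q, R q ∈ complV A B ∧ B (R q) = q := by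
  obtain ⟨R, hR⟩ := hB.exists_rightInverse
  obtain ⟨P, hP⟩ := exists_projection_kerV hA
  -- Subtracting the `V_ker` component moves the range into `V_c` and is not seen by `B`.
  refine ⟨R - P ∘L R, fun q => ⟨(hP (R q)).2, ?_⟩⟩
  have : B (P (R q)) = 0 := (hP (R q)).1
  simp [hR, this]

lemma eq_of_mem_complV {A : V →L[ℝ] StrongDual ℝ V} {B : V →L[ℝ] StrongDual ℝ Q}
    (hA : ∃ α : ℝ, 0 < α ∧ ∀ v ∈ kerV B, α * ‖v‖ ^ 2 ≤ A v v) {c c' : V}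
    (hc : c ∈ complV A B) (hc' : c' ∈ complV A B) (h : B c = B c') : c = c' := by
  obtain ⟨α, hα, hA⟩ := hA
  have hk : c - c' ∈ kerV B := by
    change B (c - c') = 0
    simp [h]
  have h0 : A (c - c') (c - c') = 0 := (complV A B).sub_mem hc hc' _ hk
  have h1 := hA _ hk
  have : ‖c - c'‖ ^ 2 ≤ 0 := by nlinarith
  have : ‖c - c'‖ = 0 := by nlinarith [norm_nonneg (c - c')]
  exact sub_eq_zero.1 (norm_eq_zero.1 this)

/-- Gårding's inequality on `V_ker` for the self-adjoint part of `A`. -/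
lemma exists_garding {J : V →L[ℝ] H} {A A₁ : V →L[ℝ] StrongDual ℝ V} {A₂ : V →L[ℝ] H}
    {B : V →L[ℝ] StrongDual ℝ Q} (hA : ∃ α : ℝ, 0 < α ∧ ∀ v ∈ kerV B, α * ‖v‖ ^ 2 ≤ A v v)
    (h : ∀ v φ, A v φ = A₁ v φ + inner ℝ (A₂ v) (J φ)) :
    ∃ c κ : ℝ, 0 < c ∧ 0 ≤ κ ∧ ∀ v ∈ kerV B, c * ‖v‖ ^ 2 ≤ A₁ v v + κ * ‖J v‖ ^ 2 := by
  obtain ⟨α, hα, hA⟩ := hA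
  refine ⟨α / 2, ‖A₂‖ ^ 2 / (2 * α), by positivity, by positivity, fun v hv => ?_⟩
  have h1 := hA v hv
  rw [h] at h1
  have h2 : inner ℝ (A₂ v) (J v) ≤ ‖A₂‖ * ‖v‖ * ‖J v‖ :=
    (real_inner_le_norm _ _).trans (by gcongr; exact A₂.le_opNorm v)
  have h3 : ‖A₂‖ * ‖v‖ * ‖J v‖ ≤ α / 2 * ‖v‖ ^ 2 + ‖A₂‖ ^ 2 / (2 * α) * ‖J v‖ ^ 2 := by
    -- Young's inequality by completing the square; this fixes the choice of `κ`.
    have : α / 2 * ‖v‖ ^ 2 + ‖A₂‖ ^ 2 / (2 * α) * ‖J v‖ ^ 2 - ‖A₂‖ * ‖v‖ * ‖J v‖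
      = (α * ‖v‖ - ‖A₂‖ * ‖J v‖) ^ 2 / (2 * α) := by field_simp; ring
    have : 0 ≤ (α * ‖v‖ - ‖A₂‖ * ‖J v‖) ^ 2 / (2 * α) := by positivity
    linarith
  linarith

lemma map_mem_kerH {J : V →L[ℝ] H} {B : V →L[ℝ] StrongDual ℝ Q} {φ : V} (hφ : φ ∈ kerV B) :
    J φ ∈ kerH J B :=
  Submodule.le_topologicalClosure _ ⟨φ, hφ, rfl⟩

instance [CompleteSpace H] (J : V →L[ℝ] H) (B : V →L[ℝ] StrongDual ℝ Q) :
    CompleteSpace (kerH J B) :=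
  (Submodule.isClosed_topologicalClosure _).completeSpace_coe

/-- The orthogonal projection of `H` onto `H_ker`. -/
def projH [CompleteSpace H] (J : V →L[ℝ] H) (B : V →L[ℝ] StrongDual ℝ Q) : H →L[ℝ] H :=
  (kerH J B).starProjection

lemma norm_projH_le [CompleteSpace H] (J : V →L[ℝ] H) (B : V →L[ℝ] StrongDual ℝ Q) (x : H) :
    ‖projH J B x‖ ≤ ‖x‖ :=
  (kerH J B).norm_starProjection_apply_le x

lemma projH_eq_self [CompleteSpace H] {J : V →L[ℝ] H} {B : V →L[ℝ] StrongDual ℝ Q} {x : H}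
    (hx : x ∈ kerH J B) : projH J B x = x :=
  Submodule.starProjection_eq_self_iff.2 hx

lemma inner_projH [CompleteSpace H] (J : V →L[ℝ] H) (B : V →L[ℝ] StrongDual ℝ Q) (x : H)
    {φ : V} (hφ : φ ∈ kerV B) : inner ℝ (projH J B x) (J φ) = inner ℝ x (J φ) := by
  rw [projH, Submodule.inner_starProjection_left_eq_right,
    Submodule.starProjection_eq_self_iff.2 (map_mem_kerH hφ)]

lemma projH_eq_zero [CompleteSpace H] {J : V →L[ℝ] H} {B : V →L[ℝ] StrongDual ℝ Q} {x : H}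
    (hx : ∀ φ ∈ kerV B, inner ℝ x (J φ) = 0) : projH J B x = 0 := by
  rw [projH, Submodule.starProjection_apply_eq_zero_iff, Submodule.mem_orthogonal']
  intro y hy
  -- Orthogonality to the image of `V_ker` is a closed condition and so extends to `H_ker`.
  refine closure_minimal (s := ((kerV B).map J.toLinearMap : Set H))
    (t := {y | inner ℝ x y = 0}) ?_ (isClosed_eq (by fun_prop) (by fun_prop)) hy
  rintro _ ⟨φ, hφ, rfl⟩
  exact hx φ hφ

end FunctionalAnalysis

/-! ### Sequences of derivatives and Taylor expansions on a closed interval. -/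

section Taylor

variable {E F : Type*} [NormedAddCommGroup E] [NormedSpace ℝ E]
  [NormedAddCommGroup F] [NormedSpace ℝ F] {a b : ℝ}

/-- `d k` is the `k`-th derivative of `d 0` on `[a,b]` for `k ≤ n`, with one-sided derivatives at
the end points, and is bounded by `M`. -/
structure IsDerivSeq (n : ℕ) (d : ℕ → ℝ → E) (a b M : ℝ) : Prop where
  hasDerivWithinAt : ∀ k < n, ∀ t ∈ Icc a b, HasDerivWithinAt (d k) (d (k + 1) t) (Icc a b) t
  bound : ∀ k ≤ n, ∀ t ∈ Icc a b, ‖d k t‖ ≤ M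

lemma exists_isDerivSeq (hab : a < b) {n : ℕ} {f : ℝ → E} (hf : ContDiffOn ℝ n f (Icc a b)) :
    ∃ (d : ℕ → ℝ → E) (M : ℝ), d 0 = f ∧ IsDerivSeq n d a b M := by
  have hu := uniqueDiffOn_Icc hab
  have hc : ∀ k, ∃ M, k ≤ n → ∀ t ∈ Icc a b, ‖iteratedDerivWithin k f (Icc a b) t‖ ≤ M := by
    intro k
    by_cases hk : k ≤ n
    · obtain ⟨M, hM⟩ := isCompact_Icc.exists_bound_of_continuousOn
        (hf.continuousOn_iteratedDerivWithin (m := k) (by exact_mod_cast hk) hu)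
      exact ⟨M, fun _ => hM⟩
    · exact ⟨0, fun h => absurd h hk⟩
  choose M hM using hc
  refine ⟨fun k => iteratedDerivWithin k f (Icc a b), ∑ k ∈ Finset.range (n + 1), |M k|,
    iteratedDerivWithin_zero, fun k hk t ht => ?_, fun k hk t ht => ?_⟩
  · have := (hf.differentiableOn_iteratedDerivWithin (m := k) (by exact_mod_cast hk) hu) t ht
    rw [iteratedDerivWithin_succ]
    exact this.hasDerivWithinAt
  · exact ((hM k hk t ht).trans (le_abs_self _)).trans
      (Finset.single_le_sum (f := fun k => |M k|) (fun _ _ => abs_nonneg _)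
        (Finset.mem_range.2 (by omega)))

lemma IsDerivSeq.map {n : ℕ} {d : ℕ → ℝ → E} {M : ℝ} (h : IsDerivSeq n d a b M) (L : E →L[ℝ] F) :
    IsDerivSeq n (fun k t => L (d k t)) a b (‖L‖ * M) where
  hasDerivWithinAt k hk t ht := L.hasFDerivAt.comp_hasDerivWithinAt t (h.hasDerivWithinAt k hk t ht)
  bound k hk t ht := L.le_opNorm_of_le (h.bound k hk t ht)

lemma IsDerivSeq.mono {n m : ℕ} {d : ℕ → ℝ → E} {M b' : ℝ} (h : IsDerivSeq n d a b M)
    (hm : m ≤ n) (hb : b' ≤ b) : IsDerivSeq m d a b' M where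
  hasDerivWithinAt k hk t ht := (h.hasDerivWithinAt k (hk.trans_le hm) t
    ⟨ht.1, ht.2.trans hb⟩).mono (Icc_subset_Icc_right hb)
  bound k hk t ht := h.bound k (hk.trans hm) t ⟨ht.1, ht.2.trans hb⟩

lemma IsDerivSeq.shift {n : ℕ} {d : ℕ → ℝ → E} {M : ℝ} (h : IsDerivSeq (n + 1) d a b M) :
    IsDerivSeq n (fun k => d (k + 1)) a b M where
  hasDerivWithinAt k hk := h.hasDerivWithinAt (k + 1) (by omega)
  bound k hk := h.bound (k + 1) (by omega)

/-- Two derivative sequences of the same function agree. -/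
lemma IsDerivSeq.eqOn (hab : a < b) {n : ℕ} {d d' : ℕ → ℝ → E} {M M' : ℝ}
    (h : IsDerivSeq n d a b M) (h' : IsDerivSeq n d' a b M') (h0 : EqOn (d 0) (d' 0) (Icc a b)) :
    ∀ k ≤ n, EqOn (d k) (d' k) (Icc a b) := by
  intro k
  induction k with
  | zero => exact fun _ => h0
  | succ k ih =>
    intro hk t ht
    have ih := ih (by omega)
    exact (uniqueDiffOn_Icc hab t ht).eq_deriv _ (h.hasDerivWithinAt k (by omega) t ht)
      ((h'.hasDerivWithinAt k (by omega) t ht).congr ih (ih ht))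

lemma IsDerivSeq.derivWithin_eq (hab : a < b) {n : ℕ} {d : ℕ → ℝ → E} {M : ℝ}
    (h : IsDerivSeq n d a b M) {k : ℕ} (hk : k < n) {t : ℝ} (ht : t ∈ Icc a b) :
    derivWithin (d k) (Icc a b) t = d (k + 1) t :=
  (h.hasDerivWithinAt k hk t ht).derivWithin (uniqueDiffOn_Icc hab t ht)

/-- Integration of a bound of the derivative. -/
lemma norm_le_of_hasDerivWithinAt_of_norm_le_pow {f f' : ℝ → E} {M t s : ℝ} {k : ℕ}
    (hM : 0 ≤ M) (hf : ∀ x ∈ Icc t s, HasDerivWithinAt f (f' x) (Icc t s) x) (h0 : f t = 0)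
    (hb : ∀ x ∈ Icc t s, ‖f' x‖ ≤ M * (x - t) ^ k) :
    ∀ x ∈ Icc t s, ‖f x‖ ≤ M * (x - t) ^ (k + 1) := by
  intro x hx
  have hsub : Icc t x ⊆ Icc t s := Icc_subset_Icc_right hx.2
  -- The derivative bound is frozen at its largest value on `[t, x]`. This gives up a factor `1 / (k
  -- + 1)`, so the Taylor remainders carry no factorial.
  have h := (convex_Icc t x).norm_image_sub_le_of_norm_hasDerivWithin_le (f := f) (f' := f')
    (C := M * (x - t) ^ k) (x := t) (y := x)
    (fun y hy => (hf y (hsub hy)).mono hsub)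
    (fun y hy => (hb y (hsub hy)).trans (by
      have : 0 ≤ y - t := sub_nonneg.2 hy.1
      have := hy.2
      gcongr))
    ⟨le_rfl, hx.1⟩ ⟨hx.1, le_rfl⟩
  rw [h0, sub_zero, Real.norm_eq_abs, abs_of_nonneg (sub_nonneg.2 hx.1)] at h
  rw [pow_succ, ← mul_assoc]
  exact h

/-- Taylor's formula with a bound of the remainder. -/
lemma IsDerivSeq.taylor {n : ℕ} {d : ℕ → ℝ → E} {M t s : ℝ} (h : IsDerivSeq (n + 1) d a b M)
    (ht : t ∈ Icc a b) (hs : s ∈ Icc a b) (hts : t ≤ s) :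
    ‖d 0 s - ∑ k ∈ Finset.range (n + 1), ((s - t) ^ k / (k.factorial : ℝ)) • d k t‖
      ≤ M * (s - t) ^ (n + 1) := by
  have hM : 0 ≤ M := (norm_nonneg _).trans (h.bound 0 (by omega) t ht)
  induction n generalizing d s with
  | zero =>
    have := norm_le_of_hasDerivWithinAt_of_norm_le_pow (f := fun x => d 0 x - d 0 t)
      (f' := d 1) (M := M) (t := t) (s := s) (k := 0) hM
      (fun x hx => ((h.hasDerivWithinAt 0 (by omega) x
        ⟨ht.1.trans hx.1, hx.2.trans hs.2⟩).mono (Icc_subset_Icc ht.1 hs.2)).sub_const _)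
      (by simp)
      (fun x hx => by simpa using h.bound 1 (by omega) x ⟨ht.1.trans hx.1, hx.2.trans hs.2⟩)
      s ⟨hts, le_rfl⟩
    simpa using this
  | succ n ih =>
    have hmem : ∀ x ∈ Icc t s, x ∈ Icc a b := fun x hx => ⟨ht.1.trans hx.1, hx.2.trans hs.2⟩
    -- The Taylor remainder of `d 0` has as derivative the remainder of `d 1` of one order less,
    -- which the induction hypothesis bounds.
    refine norm_le_of_hasDerivWithinAt_of_norm_le_pow
      (f := fun x => d 0 x - ∑ k ∈ Finset.range (n + 1 + 1),
        ((x - t) ^ k / (k.factorial : ℝ)) • d k t)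
      (f' := fun x => d 1 x - ∑ k ∈ Finset.range (n + 1),
        ((x - t) ^ k / (k.factorial : ℝ)) • d (k + 1) t) (M := M) (t := t) (s := s) (k := n + 1) hM
      (fun x hx => ?_) ?_ (fun x hx => ih h.shift (hmem x hx) hx.1) s ⟨hts, le_rfl⟩
    · refine ((h.hasDerivWithinAt 0 (by omega) x (hmem x hx)).mono
        (Icc_subset_Icc ht.1 hs.2)).sub ?_
      simp_rw [Finset.sum_range_succ' _ (n + 1)]
      simp only [pow_zero, Nat.factorial_zero, Nat.cast_one, div_one, one_smul]
      refine HasDerivWithinAt.add_const _ (HasDerivWithinAt.fun_sum fun k _ => ?_)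
      refine HasDerivWithinAt.smul_const ?_ _
      have h1 : HasDerivAt (fun x : ℝ => (x - t) ^ (k + 1) / ((k + 1).factorial : ℝ))
          (((k + 1 : ℕ) : ℝ) * (x - t) ^ k * 1 / ((k + 1).factorial : ℝ)) x := by
        simpa using (((hasDerivAt_id x).sub_const t).pow (k + 1)).div_const
          ((k + 1).factorial : ℝ)
      refine h1.hasDerivWithinAt.congr_deriv ?_
      rw [Nat.factorial_succ]
      push_cast
      field_simp
    · simp [Finset.sum_range_succ']

lemma IsDerivSeq.taylor_zero {d : ℕ → ℝ → E} {M t h : ℝ} (hd : IsDerivSeq 1 d a b M)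
    (ht : t ∈ Icc a b) (hs : t + h ∈ Icc a b) (hh : 0 ≤ h) :
    ‖d 0 (t + h) - d 0 t‖ ≤ M * h := by
  have := hd.taylor (n := 0) ht hs (by linarith)
  simpa using this

lemma IsDerivSeq.taylor_one {d : ℕ → ℝ → E} {M t h : ℝ} (hd : IsDerivSeq 2 d a b M)
    (ht : t ∈ Icc a b) (hs : t + h ∈ Icc a b) (hh : 0 ≤ h) :
    ‖d 0 (t + h) - (d 0 t + h • d 1 t)‖ ≤ M * h ^ 2 := by
  have := hd.taylor (n := 1) ht hs (by linarith)
  simpa [Finset.sum_range_succ] using this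

lemma IsDerivSeq.taylor_two {d : ℕ → ℝ → E} {M t h : ℝ} (hd : IsDerivSeq 3 d a b M)
    (ht : t ∈ Icc a b) (hs : t + h ∈ Icc a b) (hh : 0 ≤ h) :
    ‖d 0 (t + h) - (d 0 t + h • d 1 t + (h ^ 2 / 2) • d 2 t)‖ ≤ M * h ^ 3 := by
  have := hd.taylor (n := 2) ht hs (by linarith)
  simpa [Finset.sum_range_succ] using this

lemma IsDerivSeq.taylor_three {d : ℕ → ℝ → E} {M t h : ℝ} (hd : IsDerivSeq 4 d a b M)
    (ht : t ∈ Icc a b) (hs : t + h ∈ Icc a b) (hh : 0 ≤ h) :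
    ‖d 0 (t + h) - (d 0 t + h • d 1 t + (h ^ 2 / 2) • d 2 t + (h ^ 3 / 6) • d 3 t)‖
      ≤ M * h ^ 4 := by
  have := hd.taylor (n := 3) ht hs (by linarith)
  simpa [Finset.sum_range_succ, Nat.factorial] using this

/-- The sequence of derivatives of a primitive of `d 0`. -/
lemma IsDerivSeq.exists_primitive [CompleteSpace E] (hab : a ≤ b) {n : ℕ} {d : ℕ → ℝ → E} {M : ℝ}
    (h : IsDerivSeq (n + 1) d a b M) :
    ∃ (p : ℕ → ℝ → E) (M' : ℝ), (∀ k, p (k + 1) = d k) ∧ IsDerivSeq (n + 2) p a b M' := by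
  have hc : ContinuousOn (d 0) (Icc a b) := fun t ht =>
    (h.hasDerivWithinAt 0 (by omega) t ht).continuousWithinAt
  set f : ℝ → E := fun t => ∫ s in a..t, d 0 s with hf
  have hd : ∀ t ∈ Icc a b, HasDerivWithinAt f (d 0 t) (Icc a b) t := fun t ht => by
    have : Fact (t ∈ Icc a b) := ⟨ht⟩
    exact intervalIntegral.integral_hasDerivWithinAt_right
      ((hc.mono (by rw [uIcc_of_le ht.1]; exact Icc_subset_Icc_right ht.2)).intervalIntegrable)
      (hc.stronglyMeasurableAtFilter_nhdsWithin measurableSet_Icc t) (hc t ht)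
  have hM : 0 ≤ M := (norm_nonneg _).trans (h.bound 0 (by omega) a ⟨le_rfl, hab⟩)
  obtain ⟨M₁, hM₁⟩ := isCompact_Icc.exists_bound_of_continuousOn
    (fun t ht => (hd t ht).continuousWithinAt : ContinuousOn f (Icc a b))
  refine ⟨fun k => k.casesOn f d, max M M₁, fun k => rfl, ⟨fun k hk t ht => ?_, fun k hk t ht => ?_⟩⟩
  · cases k with
    | zero => exact hd t ht
    | succ k => exact h.hasDerivWithinAt k (by omega) t ht
  · cases k with
    | zero => exact (hM₁ t ht).trans (le_max_right _ _)
    | succ k => exact (h.bound k (by omega) t ht).trans (le_max_left _ _)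

end Taylor

/-! ### Energy and growth estimates for one step of the error equations. -/

section EnergyStep

variable {V H : Type*}
  [NormedAddCommGroup V] [InnerProductSpace ℝ V]
  [NormedAddCommGroup H] [InnerProductSpace ℝ H]

/-- The equations satisfied by the errors `e, e'` (in `V`) and `y, y'` (in `H`) before and after a
step of size `τ`, the momentum equation being tested with `e' - e`. Here `Δ, Δ'` are the
differences of the nonlinear terms and `ρ, s, r` are defects. -/
structure ErrorStep (J : V →L[ℝ] H) (A : V →L[ℝ] StrongDual ℝ V) (D₀ : V →L[ℝ] H) (τ : ℝ)
    (e e' : V) (y y' Δ Δ' S s ρ : H) (r : V) : Prop where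
  velocity_eq : J (e' - e) = (τ / 2) • (y + y' - S)
  momentum : inner ℝ (y' - y) (J (e' - e)) + inner ℝ (D₀ (e' - e)) (J (e' - e))
      + τ / 2 * A (e + e') (e' - e)
    = τ / 2 * inner ℝ (Δ + Δ') (J (e' - e)) + inner ℝ ρ (J (e' - e)) + τ * A r (e' - e)
  inner_S : inner ℝ S (J (e' - e)) = inner ℝ (s + (τ / 2) • (Δ' - Δ)) (J (e' - e))
  norm_S : ‖S‖ ≤ ‖s‖ + τ / 2 * (‖Δ‖ + ‖Δ'‖)

variable {J : V →L[ℝ] H} {A A₁ : V →L[ℝ] StrongDual ℝ V} {A₂ D₀ : V →L[ℝ] H} {τ : ℝ}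
    {e e' : V} {y y' Δ Δ' S s ρ : H} {r : V}

lemma dual_apply_le (A : V →L[ℝ] StrongDual ℝ V) (v w : V) : |A v w| ≤ ‖A‖ * ‖v‖ * ‖w‖ :=
  A.le_opNorm₂ v w

/-- The energy balance of a step. -/
lemma ErrorStep.energy_le (h : ErrorStep J A D₀ τ e e' y y' Δ Δ' S s ρ r)
    (hA : ∀ v φ, A v φ = A₁ v φ + inner ℝ (A₂ v) (J φ)) (hs : ∀ v φ, A₁ v φ = A₁ φ v)
    (hD : ∀ v, 0 ≤ inner ℝ (D₀ v) (J v)) (hτ : 0 < τ) {κ : ℝ} (hκ : 0 ≤ κ) :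
    (‖y'‖ ^ 2 + (A₁ e' e' + κ * ‖J e'‖ ^ 2)) - (‖y‖ ^ 2 + (A₁ e e + κ * ‖J e‖ ^ 2))
      ≤ ‖S‖ * (‖y‖ + ‖y'‖)
        + (τ / 2 * (‖Δ‖ + ‖Δ'‖) + ‖ρ‖ + τ / 2 * (‖A₂‖ + κ * ‖J‖) * (‖e‖ + ‖e'‖))
            * (‖y‖ + ‖y'‖ + ‖S‖)
        + 2 * (‖A‖ * ‖r‖ * (‖e‖ + ‖e'‖)) := by
  set δ := e' - e with hδ
  set Z := ‖y‖ + ‖y'‖ + ‖S‖ with hZ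
  have hJδ : ‖J δ‖ ≤ τ / 2 * Z := by
    rw [h.velocity_eq, norm_smul, Real.norm_of_nonneg (by positivity)]
    gcongr
    exact (norm_sub_le _ _).trans (add_le_add_left (norm_add_le _ _) _)
  -- The test function is, up to `S`, the mean velocity error, which turns the difference into a
  -- difference of squares.
  have h1 : inner ℝ (y' - y) (J δ) = τ / 2 * (‖y'‖ ^ 2 - ‖y‖ ^ 2 - inner ℝ (y' - y) S) := by
    rw [h.velocity_eq, inner_smul_right, ← real_inner_self_eq_norm_sq,
      ← real_inner_self_eq_norm_sq]
    simp only [inner_sub_left, inner_sub_right, inner_add_right]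
    rw [real_inner_comm y y']
    ring
  have h2 : A (e + e') δ = A₁ e' e' - A₁ e e + inner ℝ (A₂ (e + e')) (J δ) := by
    rw [hA, hδ]
    simp only [map_add, map_sub, add_apply]
    rw [hs e e']
    ring
  have h3 : ‖J e'‖ ^ 2 - ‖J e‖ ^ 2 = inner ℝ (J (e + e')) (J δ) := by
    rw [hδ, ← real_inner_self_eq_norm_sq, ← real_inner_self_eq_norm_sq]
    simp only [map_add, map_sub, inner_sub_right, inner_add_left]
    rw [real_inner_comm (J e) (J e')]
    ring
  have b1 : inner ℝ (y' - y) S ≤ ‖S‖ * (‖y‖ + ‖y'‖) := by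
    refine (real_inner_le_norm _ _).trans ?_
    rw [mul_comm, add_comm]
    exact mul_le_mul_of_nonneg_left (norm_sub_le _ _) (norm_nonneg _)
  have b2 : inner ℝ (Δ + Δ') (J δ) ≤ (‖Δ‖ + ‖Δ'‖) * (τ / 2 * Z) :=
    (real_inner_le_norm _ _).trans (by gcongr; exact norm_add_le _ _)
  have b3 : inner ℝ ρ (J δ) ≤ ‖ρ‖ * (τ / 2 * Z) := (real_inner_le_norm _ _).trans (by gcongr)
  -- The increment is measured in `V` here, so no factor `τ` is gained, in contrast to the terms
  -- with `J δ`.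
  have b4 : A r δ ≤ ‖A‖ * ‖r‖ * (‖e‖ + ‖e'‖) := by
    refine (le_abs_self _).trans ((dual_apply_le A r δ).trans ?_)
    gcongr
    rw [add_comm]
    exact norm_sub_le _ _
  have b5 : -inner ℝ (A₂ (e + e')) (J δ) ≤ ‖A₂‖ * (‖e‖ + ‖e'‖) * (τ / 2 * Z) := by
    rw [← inner_neg_left]
    refine (real_inner_le_norm _ _).trans ?_
    rw [norm_neg]
    gcongr
    exact A₂.le_opNorm_of_le (norm_add_le _ _)
  have b6 : inner ℝ (J (e + e')) (J δ) ≤ ‖J‖ * (‖e‖ + ‖e'‖) * (τ / 2 * Z) := by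
    refine (real_inner_le_norm _ _).trans ?_
    gcongr
    exact J.le_opNorm_of_le (norm_add_le _ _)
  have b6' : κ * (‖J e'‖ ^ 2 - ‖J e‖ ^ 2) ≤ κ * (‖J‖ * (‖e‖ + ‖e'‖) * (τ / 2 * Z)) := by
    rw [h3]; gcongr
  have hm := h.momentum
  rw [h1, h2] at hm
  have hd := hD δ
  have hτ2 : 0 < τ / 2 := by positivity
  have key : τ / 2 * (‖y'‖ ^ 2 - ‖y‖ ^ 2 + (A₁ e' e' - A₁ e e))
      ≤ τ / 2 * (‖S‖ * (‖y‖ + ‖y'‖) + ‖A₂‖ * (‖e‖ + ‖e'‖) * (τ / 2 * Z)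
        + (‖Δ‖ + ‖Δ'‖) * (τ / 2 * Z) + ‖ρ‖ * Z + 2 * (‖A‖ * ‖r‖ * (‖e‖ + ‖e'‖))) := by
    have c1 := mul_le_mul_of_nonneg_left b1 hτ2.le
    have c2 := mul_le_mul_of_nonneg_left b2 hτ2.le
    have c5 := mul_le_mul_of_nonneg_left b5 hτ2.le
    have c4 := mul_le_mul_of_nonneg_left b4 hτ.le
    linarith
  have key' := le_of_mul_le_mul_left key hτ2
  linarith

/-- If `d` exceeds `m`, then `m ^ 2 ≤ m * d` and a factor `d` can be cancelled. -/
lemma le_of_mul_sq_le {α a m d : ℝ} (hα : 0 < α) (ha : 0 ≤ a) (hm : 0 ≤ m)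
    (h : α * d ^ 2 ≤ 2 * a * m * d + m ^ 2) : d ≤ ((2 * a + 1) / α + 1) * m := by
  have h0 : 0 ≤ (2 * a + 1) / α * m := by positivity
  rcases le_or_gt d m with h1 | h1
  · linarith
  have hd0 : 0 < d := hm.trans_lt h1
  have h4 : α * d ≤ (2 * a + 1) * m := by
    refine le_of_mul_le_mul_right ?_ hd0
    nlinarith
  have h5 : d ≤ (2 * a + 1) / α * m := by
    rw [div_mul_eq_mul_div, le_div_iff₀ hα]
    linarith
  linarith

/-- A step increases the error `e` by a bounded factor, whatever the nonlinear term at the new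
time. -/
lemma ErrorStep.norm_increment_le (h : ErrorStep J A D₀ τ e e' y y' Δ Δ' S s ρ r) {α : ℝ} (hα : 0 < α)
    (hA : α * ‖e' - e‖ ^ 2 ≤ A (e' - e) (e' - e))
    (hD : ∀ v, 0 ≤ inner ℝ (D₀ v) (J v)) (hτ : 0 < τ) :
    ‖e' - e‖ ≤ ((2 * ‖A‖ + 1) / α + 1)
      * (‖e‖ + ‖r‖ + (2 * ‖y‖ + τ * ‖Δ‖ + ‖ρ‖ + ‖s‖)) := by
  set δ := e' - e with hδ
  set Y := 2 * ‖y‖ + τ * ‖Δ‖ + ‖ρ‖ + ‖s‖ with hY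
  have hY0 : 0 ≤ Y := by positivity
  set m := ‖e‖ + ‖r‖ + Y with hm
  have hm0 : 0 ≤ m := by positivity
  have hv : y' - y = (2 / τ) • J δ - (2 : ℝ) • y + S := by
    rw [h.velocity_eq, smul_smul, div_mul_div_cancel₀' (by norm_num), div_self hτ.ne']
    module
  have hmom := h.momentum
  rw [← hδ, hv] at hmom
  have he : e + e' = δ + (2 : ℝ) • e := by rw [hδ]; module
  rw [he] at hmom
  -- The exact pairing with `S` is needed, not `norm_S`: it contains `τ / 2` times the pairing with
  -- `Δ'`, which cancels that on the right of the momentum equation and leaves `τ` times the one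
  -- with `Δ`.
  have hS := h.inner_S
  simp only [inner_add_left, inner_sub_left, inner_smul_left, map_add, map_smul,
    add_apply, smul_apply, smul_eq_mul, RCLike.conj_to_real,
    ← hδ, real_inner_self_eq_norm_sq] at hmom hS
  have b0 := hD δ
  have b1 : inner ℝ y (J δ) ≤ ‖y‖ * ‖J δ‖ := real_inner_le_norm _ _
  have b2 : inner ℝ Δ (J δ) ≤ ‖Δ‖ * ‖J δ‖ := real_inner_le_norm _ _
  have b3 : inner ℝ ρ (J δ) ≤ ‖ρ‖ * ‖J δ‖ := real_inner_le_norm _ _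
  have b4 : -inner ℝ s (J δ) ≤ ‖s‖ * ‖J δ‖ := by
    rw [← inner_neg_left]
    exact (real_inner_le_norm _ _).trans (by rw [norm_neg])
  have b5 : A r δ ≤ ‖A‖ * ‖r‖ * ‖δ‖ := (le_abs_self _).trans (dual_apply_le A r δ)
  have b6 : -A e δ ≤ ‖A‖ * ‖e‖ * ‖δ‖ := (neg_le_abs _).trans (dual_apply_le A e δ)
  -- The term `2 / τ * ‖J δ‖ ^ 2` absorbs everything linear in `J δ` and leaves a factor `τ`, to be
  -- cancelled against that of the `A` term.
  have b7 : Y * ‖J δ‖ - 2 / τ * ‖J δ‖ ^ 2 ≤ τ / 2 * m ^ 2 := by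
    have h1 : τ / 8 * Y ^ 2 - (Y * ‖J δ‖ - 2 / τ * ‖J δ‖ ^ 2)
        = (τ * Y - 4 * ‖J δ‖) ^ 2 / (8 * τ) := by field_simp; ring
    have h2 : 0 ≤ (τ * Y - 4 * ‖J δ‖) ^ 2 / (8 * τ) := by positivity
    have h3 : Y ^ 2 ≤ m ^ 2 := by
      gcongr
      have := norm_nonneg e
      have := norm_nonneg r
      linarith
    nlinarith
  have c2 := mul_le_mul_of_nonneg_left b2 hτ.le
  have c5 := mul_le_mul_of_nonneg_left b5 hτ.le
  have c6 := mul_le_mul_of_nonneg_left b6 hτ.le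
  have cA := mul_le_mul_of_nonneg_left hA (show 0 ≤ τ / 2 by positivity)
  have hYe : Y * ‖J δ‖ = 2 * (‖y‖ * ‖J δ‖) + τ * (‖Δ‖ * ‖J δ‖) + ‖ρ‖ * ‖J δ‖ + ‖s‖ * ‖J δ‖ := by
    rw [hY]; ring
  have k1 : τ / 2 * (α * ‖δ‖ ^ 2)
      ≤ τ / 2 * (2 * (‖A‖ * ‖e‖ * ‖δ‖) + 2 * (‖A‖ * ‖r‖ * ‖δ‖) + m ^ 2) := by
    linarith
  have k2 := le_of_mul_le_mul_left k1 (by positivity)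
  have k3 : α * ‖δ‖ ^ 2 ≤ 2 * ‖A‖ * m * ‖δ‖ + m ^ 2 := by
    refine k2.trans ?_
    have : ‖A‖ * ‖δ‖ * (‖e‖ + ‖r‖) ≤ ‖A‖ * ‖δ‖ * m := by gcongr; linarith
    linarith
  exact le_of_mul_sq_le hα (norm_nonneg A) hm0 k3

/-- The factor `2 / τ` is harmless, since the bound serves only for a fixed step size, in
`IsErrorSeq.exists_bound`. -/
lemma ErrorStep.norm_velocity_le (h : ErrorStep J A D₀ τ e e' y y' Δ Δ' S s ρ r) (hτ : 0 < τ) :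
    ‖y'‖ ≤ 2 / τ * (‖J‖ * ‖e' - e‖) + ‖y‖ + (‖s‖ + τ / 2 * (‖Δ‖ + ‖Δ'‖)) := by
  have hv : y' = (2 / τ) • J (e' - e) - y + S := by
    rw [h.velocity_eq, smul_smul, div_mul_div_cancel₀' (by norm_num), div_self hτ.ne']
    module
  rw [hv]
  refine (norm_add_le _ _).trans (add_le_add ((norm_sub_le _ _).trans ?_) h.norm_S)
  gcongr
  rw [norm_smul, Real.norm_of_nonneg (by positivity)]
  gcongr
  exact J.le_opNorm _

end EnergyStep

/-- A discrete Gronwall inequality for an implicit recursion. -/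
lemma discrete_gronwall {E : ℕ → ℝ} {K τ ω T : ℝ} {n : ℕ} (hE : ∀ m ≤ n, 0 ≤ E m) (hK : 0 ≤ K)
    (hτ : 0 ≤ τ) (hKτ : K * τ ≤ 1 / 2) (hω : 0 ≤ ω) (hn : n * τ ≤ T)
    (h : ∀ m < n, E (m + 1) - E m ≤ K * τ * (E m + E (m + 1) + ω)) :
    E n ≤ Real.exp (4 * K * T) * (E 0 + ω) := by
  have hx : 0 ≤ K * τ := by positivity
  have h1 : ∀ m ≤ n, E m + ω ≤ (1 + 4 * (K * τ)) ^ m * (E 0 + ω) := by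
    intro m
    induction m with
    | zero => simp
    | succ m ih =>
      intro hm
      have h2 := ih (by omega)
      have h3 := h m (by omega)
      have h4 := hE m (by omega)
      have h5 : E (m + 1) + ω ≤ (1 + 4 * (K * τ)) * (E m + ω) := by
        -- With `x = K τ ≤ 1 / 2`, the recursion has growth factor `(1 + x) / (1 - x)`, and `(1 - x)
        -- (1 + 4 x) - (1 + x) = 4 x (1 / 2 - x) ≥ 0`.
        have h6 : (1 - K * τ) * (E (m + 1) + ω) ≤ (1 - K * τ) * ((1 + 4 * (K * τ)) * (E m + ω)) := by
          have : 0 ≤ K * τ * (1 / 2 - K * τ) * (E m + ω) := by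
            have : 0 ≤ 1 / 2 - K * τ := by linarith
            positivity
          nlinarith
        exact le_of_mul_le_mul_left h6 (by linarith)
      calc E (m + 1) + ω ≤ (1 + 4 * (K * τ)) * (E m + ω) := h5
        _ ≤ (1 + 4 * (K * τ)) * ((1 + 4 * (K * τ)) ^ m * (E 0 + ω)) := by gcongr
        _ = _ := by ring
  have h0 : 0 ≤ E 0 + ω := add_nonneg (hE 0 (by omega)) hω
  have h2 : (1 + 4 * (K * τ)) ^ n ≤ Real.exp (4 * K * T) := by
    calc (1 + 4 * (K * τ)) ^ n ≤ Real.exp (4 * (K * τ)) ^ n := by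
          gcongr
          linarith [Real.add_one_le_exp (4 * (K * τ))]
      _ = Real.exp (4 * K * (n * τ)) := by rw [← Real.exp_nat_mul]; ring_nf
      _ ≤ _ := by gcongr
  have h3 := h1 n le_rfl
  have h4 := mul_le_mul_of_nonneg_right h2 h0
  linarith

/-! ### Local errors of quadrature and difference formulas. -/

section Quadrature

variable {E : Type*} [NormedAddCommGroup E] [NormedSpace ℝ E] {a b t h : ℝ}

lemma IsDerivSeq.nonneg {n : ℕ} {d : ℕ → ℝ → E} {M : ℝ} (hd : IsDerivSeq n d a b M)
    (ht : t ∈ Icc a b) : 0 ≤ M :=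
  (norm_nonneg _).trans (hd.bound 0 (by omega) t ht)

/-- The trapezoidal rule for a primitive. -/
lemma IsDerivSeq.trapezoid {q : ℕ → ℝ → E} {M : ℝ} (hq : IsDerivSeq 3 q a b M)
    (ht : t ∈ Icc a b) (hs : t + h ∈ Icc a b) (hh : 0 ≤ h) :
    ‖q 0 (t + h) - q 0 t - (h / 2) • (q 1 t + q 1 (t + h))‖ ≤ 2 * M * h ^ 3 := by
  have h0 := hq.taylor_two ht hs hh
  have h1 := hq.shift.taylor_one ht hs hh
  have hM := hq.nonneg ht
  have : q 0 (t + h) - q 0 t - (h / 2) • (q 1 t + q 1 (t + h))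
      = (q 0 (t + h) - (q 0 t + h • q 1 t + (h ^ 2 / 2) • q 2 t))
        - (h / 2) • (q 1 (t + h) - (q 1 t + h • q 2 t)) := by module
  rw [this]
  refine (norm_sub_le _ _).trans ?_
  rw [norm_smul, Real.norm_of_nonneg (by positivity)]
  have h2 := mul_le_mul_of_nonneg_left h1 (show 0 ≤ h / 2 by positivity)
  have : 0 ≤ M * h ^ 3 := by positivity
  simp only [zero_add, one_add_one_eq_two] at h2
  nlinarith

/-- The trapezoidal rule with a correction of its leading error term. -/
lemma IsDerivSeq.corrected_trapezoid {p : ℕ → ℝ → E} {M : ℝ} (hp : IsDerivSeq 4 p a b M)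
    (ht : t ∈ Icc a b) (hs : t + h ∈ Icc a b) (hh : 0 ≤ h) :
    ‖(h / 2) • (p 1 t + p 1 (t + h)) - (h ^ 3 / 24) • (p 3 t + p 3 (t + h))
      - (p 0 (t + h) - p 0 t)‖ ≤ 2 * M * h ^ 4 := by
  have h0 := hp.taylor_three ht hs hh
  have h1 := hp.shift.taylor_two ht hs hh
  have h3 := hp.shift.shift.shift.taylor_zero ht hs hh
  have hM := hp.nonneg ht
  have : (h / 2) • (p 1 t + p 1 (t + h)) - (h ^ 3 / 24) • (p 3 t + p 3 (t + h))
      - (p 0 (t + h) - p 0 t)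
      = (h / 2) • (p 1 (t + h) - (p 1 t + h • p 2 t + (h ^ 2 / 2) • p 3 t))
        - (h ^ 3 / 24) • (p 3 (t + h) - p 3 t)
        - (p 0 (t + h) - (p 0 t + h • p 1 t + (h ^ 2 / 2) • p 2 t + (h ^ 3 / 6) • p 3 t)) := by
    module
  rw [this]
  refine (norm_sub_le _ _).trans ((add_le_add_left (norm_sub_le _ _) _).trans ?_)
  rw [norm_smul, norm_smul, Real.norm_of_nonneg (by positivity), Real.norm_of_nonneg (by positivity)]
  have h1' := mul_le_mul_of_nonneg_left h1 (show 0 ≤ h / 2 by positivity)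
  have h3' := mul_le_mul_of_nonneg_left h3 (show 0 ≤ h ^ 3 / 24 by positivity)
  have : 0 ≤ M * h ^ 4 := by positivity
  simp only [zero_add, Nat.reduceAdd] at h1' h3'
  nlinarith

/-- The central difference quotient, expanded at its left node. -/
lemma IsDerivSeq.central_difference {g : ℕ → ℝ → E} {M : ℝ} (hg : IsDerivSeq 3 g a b M)
    (ht : t ∈ Icc a b) (hs : t + h ∈ Icc a b) (hh : 0 < h) :
    ‖g 1 (t + h / 2) - h⁻¹ • (g 0 (t + h) - g 0 t)‖ ≤ 2 * M * h ^ 2 := by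
  have hs' : t + h / 2 ∈ Icc a b := ⟨by linarith [ht.1], by linarith [hs.2]⟩
  have h0 := hg.taylor_two ht hs hh.le
  have h1 := hg.shift.taylor_one ht hs' (by positivity)
  have hM := hg.nonneg ht
  -- Evaluation at the midpoint makes the terms with `g 2 t` cancel.
  have : g 1 (t + h / 2) - h⁻¹ • (g 0 (t + h) - g 0 t)
      = (g 1 (t + h / 2) - (g 1 t + (h / 2) • g 2 t))
        - h⁻¹ • (g 0 (t + h) - (g 0 t + h • g 1 t + (h ^ 2 / 2) • g 2 t)) := by
    match_scalars <;> field_simp <;> ring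
  rw [this]
  refine (norm_sub_le _ _).trans ?_
  rw [norm_smul, Real.norm_of_nonneg (by positivity)]
  have h0' := mul_le_mul_of_nonneg_left h0 (inv_nonneg.2 hh.le)
  have : h⁻¹ * (M * h ^ 3) = M * h ^ 2 := by field_simp
  simp only [zero_add, Nat.reduceAdd] at h1 h0'
  have : 0 ≤ M * h ^ 2 := by positivity
  nlinarith

/-- The defect in the relation between velocities and difference quotients of positions, with
corrections `h² y` of the position and `h² (y' + F' / 4 - x''' / 12)` of the velocity. -/
lemma velocity_defect {x y F : ℕ → ℝ → E} {Mx My MF : ℝ} (hx : IsDerivSeq 4 x a b Mx)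
    (hy : IsDerivSeq 2 y a b My) (hF : IsDerivSeq 2 F a b MF) {c : ℝ → E}
    (hc : ∀ t, c t = y 1 t + (1 / 4 : ℝ) • F 1 t - (1 / 12 : ℝ) • x 3 t)
    (ht : t ∈ Icc a b) (hs : t + h ∈ Icc a b) (hh : 0 < h) :
    ‖c (t + h) - c t‖ ≤ (My + MF + Mx) * h ∧
    ‖(x 1 (t + h) + h ^ 2 • c (t + h)) + (x 1 t + h ^ 2 • c t)
      - (2 / h) • ((x 0 (t + h) + h ^ 2 • y 0 (t + h)) - (x 0 t + h ^ 2 • y 0 t))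
      - (h / 2) • (F 0 (t + h) - F 0 t)‖ ≤ (4 * Mx + 3 * My + 2 * MF) * h ^ 3 := by
  have x0 := hx.taylor_three ht hs hh.le
  have x1 := hx.shift.taylor_two ht hs hh.le
  have x3 := hx.shift.shift.shift.taylor_zero ht hs hh.le
  have y0 := hy.taylor_one ht hs hh.le
  have y1 := hy.shift.taylor_zero ht hs hh.le
  have F0 := hF.taylor_one ht hs hh.le
  have F1 := hF.shift.taylor_zero ht hs hh.le
  have hMx := hx.nonneg ht
  have hMy := hy.nonneg ht
  have hMF := hF.nonneg ht
  simp only [zero_add, Nat.reduceAdd] at x0 x1 x3 y0 y1 F0 F1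
  have hcd : ‖c (t + h) - c t‖ ≤ (My + MF + Mx) * h := by
    have : c (t + h) - c t = (y 1 (t + h) - y 1 t) + (1 / 4 : ℝ) • (F 1 (t + h) - F 1 t)
        - (1 / 12 : ℝ) • (x 3 (t + h) - x 3 t) := by rw [hc, hc]; module
    rw [this]
    refine (norm_sub_le _ _).trans ((add_le_add_left (norm_add_le _ _) _).trans ?_)
    rw [norm_smul, norm_smul, Real.norm_of_nonneg (by positivity),
      Real.norm_of_nonneg (by positivity)]
    have : 0 ≤ MF * h := by positivity
    have : 0 ≤ Mx * h := by positivity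
    linarith
  refine ⟨hcd, ?_⟩
  -- At `t`, the terms of order `h ^ 2` have the sum `x''' / 6 - 2 y' - F' / 2 + 2 c`, which
  -- vanishes by the choice of `c`.
  have : (x 1 (t + h) + h ^ 2 • c (t + h)) + (x 1 t + h ^ 2 • c t)
      - (2 / h) • ((x 0 (t + h) + h ^ 2 • y 0 (t + h)) - (x 0 t + h ^ 2 • y 0 t))
      - (h / 2) • (F 0 (t + h) - F 0 t)
      = (x 1 (t + h) - (x 1 t + h • x 2 t + (h ^ 2 / 2) • x 3 t))
        - (2 / h) • (x 0 (t + h)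
          - (x 0 t + h • x 1 t + (h ^ 2 / 2) • x 2 t + (h ^ 3 / 6) • x 3 t))
        - (2 * h) • (y 0 (t + h) - (y 0 t + h • y 1 t))
        + h ^ 2 • (c (t + h) - c t)
        - (h / 2) • (F 0 (t + h) - (F 0 t + h • F 1 t)) := by
    rw [hc t]
    match_scalars <;> field_simp <;> ring
  rw [this]
  refine (norm_sub_le _ _).trans ((add_le_add_left ((norm_add_le _ _).trans (add_le_add_left
    ((norm_sub_le _ _).trans (add_le_add_left (norm_sub_le _ _) _)) _)) _).trans ?_)
  simp only [norm_smul]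
  rw [Real.norm_of_nonneg (show 0 ≤ 2 / h by positivity),
    Real.norm_of_nonneg (show 0 ≤ 2 * h by positivity),
    Real.norm_of_nonneg (show 0 ≤ h ^ 2 by positivity),
    Real.norm_of_nonneg (show 0 ≤ h / 2 by positivity)]
  have k0 := mul_le_mul_of_nonneg_left x0 (show 0 ≤ 2 / h by positivity)
  have k1 := mul_le_mul_of_nonneg_left y0 (show 0 ≤ 2 * h by positivity)
  have k2 := mul_le_mul_of_nonneg_left hcd (show 0 ≤ h ^ 2 by positivity)
  have k3 := mul_le_mul_of_nonneg_left F0 (show 0 ≤ h / 2 by positivity)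
  have : 2 / h * (Mx * h ^ 4) = 2 * (Mx * h ^ 3) := by field_simp
  have : 0 ≤ MF * h ^ 3 := by positivity
  linarith

end Quadrature

/-! ### The corrected exact solution and its defects. -/

section Comparison

variable {V H Q : Type*}
  [NormedAddCommGroup V] [InnerProductSpace ℝ V]
  [NormedAddCommGroup H] [InnerProductSpace ℝ H]
  [NormedAddCommGroup Q] [InnerProductSpace ℝ Q]

/-- `a` and `b` are corrections of the position and of the velocity such that `u + τ² a` and
`u̇ + τ² b` satisfy the equations of the scheme up to defects of order `τ³`. -/
structure IsCorrection (J : V →L[ℝ] H) (A : V →L[ℝ] StrongDual ℝ V)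
    (B : V →L[ℝ] StrongDual ℝ Q) (D₀ : V →L[ℝ] H) (F : ℝ → H) (T : ℝ) (u : ℝ → V) (v : ℝ → H)
    (a : ℝ → V) (b : ℝ → H) (C : ℝ) : Prop where
  mem_kerV : ∀ t, a t ∈ kerV B
  bound : ∀ t ∈ Icc 0 T, ‖a t‖ ≤ C ∧ ‖b t‖ ≤ C
  defect : ∀ t ∈ Icc 0 T, ∀ τ > 0, t + τ ∈ Icc 0 T → ∃ (s ρ : H) (r : V),
    ‖s‖ ≤ C * τ ^ 3 ∧ ‖ρ‖ ≤ C * τ ^ 3 ∧ ‖r‖ ≤ C * τ ^ 3 ∧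
    (v (t + τ) + τ ^ 2 • b (t + τ)) + (v t + τ ^ 2 • b t)
      - (2 / τ) • J ((u (t + τ) + τ ^ 2 • a (t + τ)) - (u t + τ ^ 2 • a t))
      - (τ / 2) • (F (t + τ) - F t) = s ∧
    ∀ φ ∈ kerV B,
      inner ℝ ((v (t + τ) + τ ^ 2 • b (t + τ)) - (v t + τ ^ 2 • b t)) (J φ)
        + inner ℝ (D₀ ((u (t + τ) + τ ^ 2 • a (t + τ)) - (u t + τ ^ 2 • a t))) (J φ)
        + τ / 2 * A ((u t + τ ^ 2 • a t) + (u (t + τ) + τ ^ 2 • a (t + τ))) φ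
      = τ / 2 * inner ℝ (F t + F (t + τ)) (J φ) + inner ℝ ρ (J φ) + τ * A r φ

lemma IsDerivSeq.sub' {n : ℕ} {d d' : ℕ → ℝ → H} {x y M M' : ℝ} (h : IsDerivSeq n d x y M)
    (h' : IsDerivSeq n d' x y M') : IsDerivSeq n (fun k t => d k t - d' k t) x y (M + M') where
  hasDerivWithinAt k hk t ht := (h.hasDerivWithinAt k hk t ht).sub (h'.hasDerivWithinAt k hk t ht)
  bound k hk t ht := (norm_sub_le _ _).trans (add_le_add (h.bound k hk t ht) (h'.bound k hk t ht))

/-- The momentum equation, integrated in time and tested with `V_ker`. -/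
lemma integrated_momentum {J : V →L[ℝ] H} {A : V →L[ℝ] StrongDual ℝ V} {D₀ : V →L[ℝ] H}
    {T : ℝ} {p : ℕ → ℝ → V} {x q : ℕ → ℝ → H} {Mp Mx Mq : ℝ}
    (hp : IsDerivSeq 4 p 0 T Mp) (hx : IsDerivSeq 4 x 0 T Mx) (hq : IsDerivSeq 3 q 0 T Mq) {φ : V}
    (h : ∀ t ∈ Icc 0 T, inner ℝ (x 2 t) (J φ) + inner ℝ (D₀ (p 2 t)) (J φ) + A (p 1 t) φ
      = inner ℝ (q 1 t) (J φ)) {t s : ℝ} (ht : t ∈ Icc 0 T) (hs : s ∈ Icc 0 T) :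
    inner ℝ (x 1 s - x 1 t) (J φ) + inner ℝ (D₀ (p 1 s - p 1 t)) (J φ) + A (p 0 s - p 0 t) φ
      = inner ℝ (q 0 s - q 0 t) (J φ) := by
  let l : H →L[ℝ] ℝ := (innerSL ℝ).flip (J φ)
  let m : V →L[ℝ] ℝ := A.flip φ
  -- The momentum equation says that this combination of primitives has zero derivative.
  have hd : ∀ z ∈ Icc 0 T, HasDerivWithinAt
      (fun z => l (x 1 z) + l (D₀ (p 1 z)) + m (p 0 z) - l (q 0 z)) 0 (Icc 0 T) z := by
    intro z hz
    have h1 := l.hasFDerivAt.comp_hasDerivWithinAt z (hx.hasDerivWithinAt 1 (by omega) z hz)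
    have h2 := (l ∘L D₀).hasFDerivAt.comp_hasDerivWithinAt z
      (hp.hasDerivWithinAt 1 (by omega) z hz)
    have h3 := m.hasFDerivAt.comp_hasDerivWithinAt z (hp.hasDerivWithinAt 0 (by omega) z hz)
    have h4 := l.hasFDerivAt.comp_hasDerivWithinAt z (hq.hasDerivWithinAt 0 (by omega) z hz)
    refine (((h1.add h2).add h3).sub h4).congr_deriv ?_
    have := h z hz
    simp only [l, m, ContinuousLinearMap.comp_apply, ContinuousLinearMap.flip_apply,
      innerSL_apply_apply]
    linarith
  have := (convex_Icc 0 T).norm_image_sub_le_of_norm_hasDerivWithin_le (C := 0) hd (by simp) ht hs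
  rw [zero_mul, norm_le_zero_iff] at this
  simp only [l, m, ContinuousLinearMap.flip_apply, innerSL_apply_apply] at this
  simp only [inner_sub_left, map_sub, sub_apply]
  linarith

/-- The trapezoidal rule for `A u` errs by `τ³ / 12 · A ü` to leading order, which `a = -ü / 12`
would cancel. Its `V_c` part is removed so that `B` does not see the correction; functionals on
`V_ker` do not notice this, as `A` maps `V_c` to zero there. The velocity correction `b` is then
forced by the velocity relation. -/
lemma exists_isCorrection [CompleteSpace V] [CompleteSpace H]
    {J : V →L[ℝ] H} {A : V →L[ℝ] StrongDual ℝ V} {B : V →L[ℝ] StrongDual ℝ Q} {D₀ : V →L[ℝ] H}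
    {R : StrongDual ℝ Q →L[ℝ] V} (hR : ∀ q, R q ∈ complV A B ∧ B (R q) = q)
    {T : ℝ} (hT : 0 < T) {du : ℕ → ℝ → V} {dg : ℕ → ℝ → StrongDual ℝ Q} {x F : ℕ → ℝ → H}
    {Mu Mg Mx MF : ℝ} (hu : IsDerivSeq 3 du 0 T Mu) (hg : IsDerivSeq 4 dg 0 T Mg)
    (hx : IsDerivSeq 4 x 0 T Mx) (hF : IsDerivSeq 2 F 0 T MF)
    (hux : ∀ k ≤ 3, ∀ t ∈ Icc 0 T, J (du k t) = x k t)
    (hug : ∀ k ≤ 3, ∀ t ∈ Icc 0 T, B (du k t) = dg k t)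
    (hdyn : ∀ t ∈ Icc 0 T, ∀ φ ∈ kerV B,
      inner ℝ (x 2 t) (J φ) + inner ℝ (D₀ (du 1 t)) (J φ) + A (du 0 t) φ
        = inner ℝ (F 0 t) (J φ)) :
    ∃ (a : ℝ → V) (b : ℝ → H) (C : ℝ),
      0 ≤ C ∧ IsCorrection J A B D₀ (F 0) T (du 0) (x 1) a b C := by
  obtain ⟨p, Mp, hpu, hp⟩ := hu.exists_primitive hT.le
  obtain ⟨q, Mq, hqF, hq⟩ := hF.exists_primitive hT.le
  let L : V →L[ℝ] V := (-(1 / 12) : ℝ) • (ContinuousLinearMap.id ℝ V - R ∘L B)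
  have hLk : ∀ v, L v ∈ kerV B := fun v => by
    refine Submodule.smul_mem _ _ ?_
    change B (v - R (B v)) = 0
    rw [map_sub, (hR _).2, sub_self]
  have hLA : ∀ v, ∀ φ ∈ kerV B, A (L v) φ = -(1 / 12) * A v φ := fun v φ hφ => by
    have := (hR (B v)).1 φ hφ
    simp [L, this]
  -- In `V`, the correction is controlled only up to its first derivative. Two derivatives are
  -- available in `H`, because `B u = g` expresses `J (L ü)` through `J u` and `g`, both of class
  -- `C⁴`.
  obtain ⟨y, My, hy, hy0⟩ : ∃ (y : ℕ → ℝ → H) (My : ℝ), IsDerivSeq 2 y 0 T My ∧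
      ∀ t ∈ Icc 0 T, y 0 t = J (L (du 2 t)) := by
    refine ⟨_, _, ((hx.shift.shift.sub' (hg.shift.shift.map (J ∘L R))).map
      ((-(1 / 12) : ℝ) • ContinuousLinearMap.id ℝ H)), fun t ht => ?_⟩
    have h1 := hux 2 (by omega) t ht
    have h2 := hug 2 (by omega) t ht
    simp [L, h1, h2]
  have hyseq := hu.shift.shift.map L
  have h0 : (0 : ℝ) ∈ Icc 0 T := ⟨le_rfl, hT.le⟩
  have hMx := hx.nonneg h0
  have hMy := hy.nonneg h0
  have hMF := hF.nonneg h0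
  have hMp := hp.nonneg h0
  have hMq := hq.nonneg h0
  have hMa : 0 ≤ ‖L‖ * Mu := hyseq.nonneg h0
  set b : ℝ → H := fun t => y 1 t + (1 / 4 : ℝ) • F 1 t - (1 / 12 : ℝ) • x 3 t with hb
  set C := ‖L‖ * Mu + (4 * Mx + 3 * My + 2 * MF) + 2 * Mp + (2 * Mq + ‖D₀‖ * (‖L‖ * Mu)) with hC
  have hD0 : 0 ≤ ‖D₀‖ * (‖L‖ * Mu) := by positivity
  refine ⟨fun t => L (du 2 t), b, 2 * C, by positivity, fun t => hLk _,
    fun t ht => ⟨?_, ?_⟩, fun t ht τ hτ hs => ?_⟩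
  · refine (hyseq.bound 0 (by omega) t ht).trans ?_
    linarith
  · have h1 := hy.bound 1 (by omega) t ht
    have h2 := hF.bound 1 (by omega) t ht
    have h3 := hx.bound 3 (by omega) t ht
    refine (norm_sub_le _ _).trans ((add_le_add_left (norm_add_le _ _) _).trans ?_)
    rw [norm_smul, norm_smul, Real.norm_of_nonneg (by positivity),
      Real.norm_of_nonneg (by positivity)]
    linarith
  obtain ⟨hbd, hvd⟩ := velocity_defect hx hy hF (c := b) (fun _ => rfl) ht hs hτ
  have htr := hq.trapezoid ht hs hτ.le
  have hct := hp.corrected_trapezoid ht hs hτ.le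
  have had := hyseq.taylor_zero ht hs hτ.le
  have hτ3 : 0 ≤ τ ^ 3 := by positivity
  simp only [zero_add, Nat.reduceAdd] at had
  set rr := (τ / 2) • (p 1 t + p 1 (t + τ)) - (τ ^ 3 / 24) • (p 3 t + p 3 (t + τ))
      - (p 0 (t + τ) - p 0 t) with hrr
  set σ := q 0 (t + τ) - q 0 t - (τ / 2) • (q 1 t + q 1 (t + τ)) with hσ
  -- Besides the quadrature error `σ` of the forcing, `ρ` collects increments of the corrections,
  -- each gaining a factor `τ`; `rr` is `O(τ⁴)`, so `r` is `O(τ³)`.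
  refine ⟨_, σ + τ ^ 2 • (b (t + τ) - b t) + τ ^ 2 • D₀ (L (du 2 (t + τ)) - L (du 2 t)),
    τ⁻¹ • rr, ?_, ?_, ?_, rfl, fun φ hφ => ?_⟩
  · rw [map_sub, map_add, map_add, map_smul, map_smul, hux 0 (by omega) t ht,
      hux 0 (by omega) _ hs, ← hy0 t ht, ← hy0 _ hs]
    refine hvd.trans ?_
    gcongr
    linarith
  · refine (norm_add_le _ _).trans ((add_le_add_left (norm_add_le _ _) _).trans ?_)
    rw [norm_smul, norm_smul, Real.norm_of_nonneg (by positivity)]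
    have h1 := mul_le_mul_of_nonneg_left hbd (sq_nonneg τ)
    have h2 := mul_le_mul_of_nonneg_left (D₀.le_opNorm_of_le had) (sq_nonneg τ)
    have h3 : (2 * Mq + (My + MF + Mx) + ‖D₀‖ * (‖L‖ * Mu)) * τ ^ 3 ≤ 2 * C * τ ^ 3 := by
      gcongr
      linarith
    linarith
  · rw [norm_smul, Real.norm_of_nonneg (by positivity), inv_mul_le_iff₀ hτ]
    refine hct.trans ?_
    have : 2 * Mp * (τ * τ ^ 3) ≤ 2 * C * (τ * τ ^ 3) := by
      gcongr
      linarith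
    linarith
  · have hmom := integrated_momentum (J := J) (A := A) (D₀ := D₀) hp hx hq (φ := φ)
      (fun z hz => by rw [hpu, hpu, hqF]; exact hdyn z hz φ hφ) ht hs
    rw [hpu] at hmom
    have hAr : τ * A (τ⁻¹ • rr) φ = A rr φ := by
      simp [hτ.ne']
    rw [hAr, hrr, hpu 0, hpu 2]
    rw [hqF 0] at hσ
    have hL1 := hLA (du 2 t) φ hφ
    have hL2 := hLA (du 2 (t + τ)) φ hφ
    have hq' : inner ℝ (q 0 (t + τ) - q 0 t) (J φ)
        = inner ℝ σ (J φ) + τ / 2 * inner ℝ (F 0 t + F 0 (t + τ)) (J φ) := by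
      rw [hσ, inner_sub_left _ ((τ / 2) • _), real_inner_smul_left]
      ring
    rw [hq'] at hmom
    simp only [inner_sub_left, inner_add_left, real_inner_smul_left, map_sub, map_add, map_smul,
      sub_apply, add_apply, smul_apply, smul_eq_mul, hL1, hL2] at hmom ⊢
    linear_combination hmom

end Comparison

/-! ### From the energy estimate to second-order bounds, uniformly in `N`. -/

section ErrorSequence

variable {V H Q : Type*}
  [NormedAddCommGroup V] [InnerProductSpace ℝ V]
  [NormedAddCommGroup H] [InnerProductSpace ℝ H]
  [NormedAddCommGroup Q] [InnerProductSpace ℝ Q]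

/-- Sequences of errors `e n`, `y n` that satisfy the error equations with defects of order `τ³`
and initial errors of order `τ²`. The differences `Δ n` of the nonlinear terms are controlled by
`e n` as long as `e n` is bounded. -/
structure IsErrorSeq (J : V →L[ℝ] H) (A : V →L[ℝ] StrongDual ℝ V) (B : V →L[ℝ] StrongDual ℝ Q)
    (D₀ : V →L[ℝ] H) (C : ℝ) (l : ℝ → ℝ) (τ : ℝ) (N : ℕ) (e : ℕ → V) (y Δ : ℕ → H) : Prop where
  mem_kerV : ∀ n ≤ N, e n ∈ kerV B
  norm_e_zero : ‖e 0‖ ≤ C * τ ^ 2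
  norm_y_zero : ‖y 0‖ ≤ C * τ ^ 2
  lipschitz : ∀ n ≤ N, ∀ σ, ‖e n‖ ≤ σ → ‖Δ n‖ ≤ l σ * (‖e n‖ + C * τ ^ 2)
  step : ∀ n < N, ∃ (S s ρ : H) (r : V),
    ‖s‖ ≤ C * τ ^ 3 ∧ ‖ρ‖ ≤ C * τ ^ 3 ∧ ‖r‖ ≤ C * τ ^ 3 ∧
    ErrorStep J A D₀ τ (e n) (e (n + 1)) (y n) (y (n + 1)) (Δ n) (Δ (n + 1)) S s ρ r

variable {J : V →L[ℝ] H} {A A₁ : V →L[ℝ] StrongDual ℝ V} {B : V →L[ℝ] StrongDual ℝ Q}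
  {A₂ D₀ : V →L[ℝ] H} {C T : ℝ} {l : ℝ → ℝ}

/-- The constant of the local energy estimate. -/
def energyConst (A : V →L[ℝ] StrongDual ℝ V) (A₂ J : V →L[ℝ] H) (κ L C T : ℝ) : ℝ :=
  5 * ((C + L * (1 + 2 * C))
    + (L * (1 + 2 * C) + C + (‖A₂‖ + κ * ‖J‖)) * (1 + T * (C + L * (1 + 2 * C))) + 2 * (‖A‖ * C))

/-- Each term of `ErrorStep.energy_le` is bounded by `τ` times a multiple of `m ^ 2`, with `m` the
sum of all errors and `τ ^ 2`; this is the form that Gronwall's inequality needs. -/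
lemma ErrorStep.energy_le_of_bounds {τ : ℝ} {e e' : V} {y y' Δ Δ' S s ρ : H} {r : V}
    (h : ErrorStep J A D₀ τ e e' y y' Δ Δ' S s ρ r)
    (hA : ∀ v φ, A v φ = A₁ v φ + inner ℝ (A₂ v) (J φ)) (hs : ∀ v φ, A₁ v φ = A₁ φ v)
    (hD : ∀ v, 0 ≤ inner ℝ (D₀ v) (J v)) (hτ : 0 < τ) (hτT : τ ≤ T) {κ L : ℝ} (hκ : 0 ≤ κ)
    (hL : 0 ≤ L) (hC : 0 ≤ C)
    (hΔ : ‖Δ‖ ≤ L * (‖e‖ + C * τ ^ 2)) (hΔ' : ‖Δ'‖ ≤ L * (‖e'‖ + C * τ ^ 2))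
    (hsn : ‖s‖ ≤ C * τ ^ 3) (hρ : ‖ρ‖ ≤ C * τ ^ 3) (hr : ‖r‖ ≤ C * τ ^ 3) :
    (‖y'‖ ^ 2 + (A₁ e' e' + κ * ‖J e'‖ ^ 2)) - (‖y‖ ^ 2 + (A₁ e e + κ * ‖J e‖ ^ 2))
      ≤ energyConst A A₂ J κ L C T * τ
          * ((‖e‖ ^ 2 + ‖y‖ ^ 2) + (‖e'‖ ^ 2 + ‖y'‖ ^ 2) + τ ^ 4) := by
  refine (h.energy_le hA hs hD hτ hκ).trans ?_
  set m := ‖e‖ + ‖e'‖ + ‖y‖ + ‖y'‖ + τ ^ 2 with hm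
  set D₁ := L * (1 + 2 * C) with hD₁
  have n1 := norm_nonneg e
  have n2 := norm_nonneg e'
  have n3 := norm_nonneg y
  have n4 := norm_nonneg y'
  have n5 := sq_nonneg τ
  have hm0 : 0 ≤ m := by positivity
  have hD₁0 : 0 ≤ D₁ := by positivity
  have hτ3 : C * τ ^ 3 ≤ τ * (C * m) := by
    have : C * τ ^ 2 ≤ C * m := by gcongr; linarith
    nlinarith
  have hΔΔ : ‖Δ‖ + ‖Δ'‖ ≤ D₁ * m := by
    have h1 : L * (‖e‖ + ‖e'‖ + 2 * C * τ ^ 2) ≤ L * ((1 + 2 * C) * m) := by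
      gcongr
      have : 2 * C * τ ^ 2 ≤ 2 * C * m := by gcongr; linarith
      linarith
    rw [hD₁, mul_assoc]
    linarith
  have hS : ‖S‖ ≤ τ * (C + D₁) * m := by
    have := mul_le_mul_of_nonneg_left hΔΔ (show 0 ≤ τ / 2 by positivity)
    have := h.norm_S
    have : 0 ≤ τ * (D₁ * m) := by positivity
    linarith
  have hT : 0 ≤ T := hτ.le.trans hτT
  have hZ : ‖y‖ + ‖y'‖ + ‖S‖ ≤ (1 + T * (C + D₁)) * m := by
    have : τ * (C + D₁) * m ≤ T * (C + D₁) * m := by gcongr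
    linarith
  -- Cauchy–Schwarz for the five summands of `m`, the origin of the `5` in `energyConst`.
  have hsq : m ^ 2 ≤ 5 * ((‖e‖ ^ 2 + ‖y‖ ^ 2) + (‖e'‖ ^ 2 + ‖y'‖ ^ 2) + τ ^ 4) := by
    have := sq_sum_le_card_mul_sum_sq (s := Finset.univ) (f := ![‖e‖, ‖e'‖, ‖y‖, ‖y'‖, τ ^ 2])
    simp only [Fin.sum_univ_five, Finset.card_univ, Fintype.card_fin, Matrix.cons_val] at this
    push_cast at this
    rw [hm]
    refine this.trans (le_of_eq ?_)
    ring
  have t1 : ‖S‖ * (‖y‖ + ‖y'‖) ≤ τ * (C + D₁) * m * m := by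
    gcongr
    linarith
  have t2 : (τ / 2 * (‖Δ‖ + ‖Δ'‖) + ‖ρ‖ + τ / 2 * (‖A₂‖ + κ * ‖J‖) * (‖e‖ + ‖e'‖))
      * (‖y‖ + ‖y'‖ + ‖S‖)
      ≤ (τ * (D₁ + C + (‖A₂‖ + κ * ‖J‖)) * m) * ((1 + T * (C + D₁)) * m) := by
    refine mul_le_mul ?_ hZ (by positivity) (by positivity)
    have h1 := mul_le_mul_of_nonneg_left hΔΔ (show 0 ≤ τ / 2 by positivity)
    have h2 : τ / 2 * (‖A₂‖ + κ * ‖J‖) * (‖e‖ + ‖e'‖) ≤ τ / 2 * (‖A₂‖ + κ * ‖J‖) * m := by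
      gcongr
      linarith
    have h3 : 0 ≤ τ * (D₁ * m) := by positivity
    have h4 : 0 ≤ τ * (‖A₂‖ + κ * ‖J‖) * m := by positivity
    linarith
  have t3 : 2 * (‖A‖ * ‖r‖ * (‖e‖ + ‖e'‖)) ≤ 2 * (‖A‖ * (τ * (C * m)) * m) := by
    gcongr
    · exact hr.trans hτ3
    · linarith
  have hK : 0 ≤ (C + D₁) + (D₁ + C + (‖A₂‖ + κ * ‖J‖)) * (1 + T * (C + D₁)) + 2 * (‖A‖ * C) := by
    positivity
  have t4 := mul_le_mul_of_nonneg_left hsq (mul_nonneg hK hτ.le)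
  rw [energyConst, ← hD₁]
  linarith

/-- The errors are bounded for a fixed number of steps of fixed size. -/
lemma IsErrorSeq.exists_bound (hA : ∃ α : ℝ, 0 < α ∧ ∀ v ∈ kerV B, α * ‖v‖ ^ 2 ≤ A v v)
    (hD : ∀ v, 0 ≤ inner ℝ (D₀ v) (J v)) (hl : ∀ σ, 0 ≤ l σ) {τ : ℝ} (hτ : 0 < τ)
    (N : ℕ) :
    ∃ R, ∀ (e : ℕ → V) (y Δ : ℕ → H), IsErrorSeq J A B D₀ C l τ N e y Δ →
      ∀ n ≤ N, ‖e n‖ ≤ R ∧ ‖y n‖ ≤ R := by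
  obtain ⟨α, hα, hA⟩ := hA
  have key : ∀ n, ∃ R, ∀ (e : ℕ → V) (y Δ : ℕ → H), IsErrorSeq J A B D₀ C l τ N e y Δ → n ≤ N →
      ‖e n‖ ≤ R ∧ ‖y n‖ ≤ R := by
    intro n
    induction n with
    | zero => exact ⟨C * τ ^ 2, fun e y Δ h _ => ⟨h.norm_e_zero, h.norm_y_zero⟩⟩
    | succ n ih =>
      obtain ⟨R, hR⟩ := ih
      set c := (2 * ‖A‖ + 1) / α + 1 with hc
      have hc0 : 0 ≤ c := by positivity
      set d := l R * (R + C * τ ^ 2) with hd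
      set R₁ := c * (R + C * τ ^ 3 + (2 * R + τ * d + C * τ ^ 3 + C * τ ^ 3)) with hR₁
      set d' := l (R + R₁) * ((R + R₁) + C * τ ^ 2) with hd'
      set R₂ := 2 / τ * (‖J‖ * R₁) + R + (C * τ ^ 3 + τ / 2 * (d + d')) with hR₂
      refine ⟨max (R + R₁) R₂, fun e y Δ h hn => ?_⟩
      obtain ⟨he, hy⟩ := hR e y Δ h (by omega)
      obtain ⟨S, s, ρ, r, hs, hρ, hr, hst⟩ := h.step n (by omega)
      have hΔ : ‖Δ n‖ ≤ d := (h.lipschitz n (by omega) R he).trans (by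
        have := hl R
        rw [hd]; gcongr)
      -- The order matters: `e (n + 1)` is bounded without `Δ (n + 1)`, and only this bound provides
      -- a Lipschitz constant for `Δ (n + 1)`.
      have hinc : ‖e (n + 1) - e n‖ ≤ R₁ := by
        refine (hst.norm_increment_le hα (hA _ ((kerV B).sub_mem (h.mem_kerV _ hn)
          (h.mem_kerV n (by omega)))) hD hτ).trans ?_
        rw [hR₁]
        gcongr
      have he' : ‖e (n + 1)‖ ≤ R + R₁ := by
        have := norm_add_le (e n) (e (n + 1) - e n)
        rw [add_sub_cancel] at this
        linarith
      have hΔ' : ‖Δ (n + 1)‖ ≤ d' := (h.lipschitz (n + 1) hn _ he').trans (by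
        have := hl (R + R₁)
        rw [hd']; gcongr)
      refine ⟨he'.trans (le_max_left _ _), ((hst.norm_velocity_le hτ).trans ?_).trans
        (le_max_right _ _)⟩
      rw [hR₂]
      gcongr
  choose R hR using key
  refine ⟨∑ n ∈ Finset.range (N + 1), |R n|, fun e y Δ h n hn => ?_⟩
  have h1 : R n ≤ ∑ n ∈ Finset.range (N + 1), |R n| := (le_abs_self _).trans
    (Finset.single_le_sum (f := fun k => |R k|) (fun _ _ => abs_nonneg _)
      (Finset.mem_range.2 (by omega)))
  exact ⟨(hR n e y Δ h hn).1.trans h1, (hR n e y Δ h hn).2.trans h1⟩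

/-- Second-order bounds of the errors as long as they are bounded. -/
lemma IsErrorSeq.exists_conditional_bound
    (hAe : ∃ α : ℝ, 0 < α ∧ ∀ v ∈ kerV B, α * ‖v‖ ^ 2 ≤ A v v)
    (hA : ∀ v φ, A v φ = A₁ v φ + inner ℝ (A₂ v) (J φ)) (hs : ∀ v φ, A₁ v φ = A₁ φ v)
    (hD : ∀ v, 0 ≤ inner ℝ (D₀ v) (J v)) (hC : 0 ≤ C) (hl : ∀ σ, 0 ≤ l σ) (hT : 0 ≤ T) :
    ∃ K G, 0 ≤ K ∧ 0 ≤ G ∧ ∀ (τ : ℝ) (N : ℕ), 0 < τ → τ ≤ T → K * τ ≤ 1 / 2 → N * τ ≤ T →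
      ∀ (e : ℕ → V) (y Δ : ℕ → H), IsErrorSeq J A B D₀ C l τ N e y Δ →
        ∀ n ≤ N, (∀ m ≤ n, ‖e m‖ ≤ 1) → ‖e n‖ ≤ G * τ ^ 2 ∧ ‖y n‖ ≤ G * τ ^ 2 := by
  obtain ⟨c, κ, hc, hκ, hcoer⟩ := exists_garding hAe hA
  obtain ⟨K₀, hK₀⟩ : ∃ K₀, K₀ = energyConst A A₂ J κ (l 1) C T := ⟨_, rfl⟩
  have hL : 0 ≤ l 1 := hl 1
  have hK₀0 : 0 ≤ K₀ := by rw [hK₀, energyConst]; positivity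
  -- `k * E n` dominates `‖e n‖ ^ 2 + ‖y n‖ ^ 2`: coercivity gives `1 / c` for the first term and
  -- `1` for the second.
  obtain ⟨k, hk⟩ : ∃ k, k = 1 + 1 / c := ⟨_, rfl⟩
  have hk1 : 1 ≤ k := by rw [hk]; linarith [show 0 ≤ 1 / c by positivity]
  obtain ⟨c₀, hc₀⟩ : ∃ c₀, c₀ = C ^ 2 + (‖A₁‖ * C ^ 2 + κ * (‖J‖ * C) ^ 2) := ⟨_, rfl⟩
  have hc₀0 : 0 ≤ c₀ := by rw [hc₀]; positivity
  have hk0 : 0 ≤ k := by linarith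
  refine ⟨K₀ * k, Real.sqrt (k * (Real.exp (4 * (K₀ * k) * T) * (c₀ + 1))), by positivity,
    Real.sqrt_nonneg _, fun τ N hτ hτT hKτ hNT e y Δ h n hn hm => ?_⟩
  obtain ⟨E, hE⟩ : ∃ E : ℕ → ℝ, ∀ n, E n = ‖y n‖ ^ 2 + (A₁ (e n) (e n) + κ * ‖J (e n)‖ ^ 2) :=
    ⟨_, fun _ => rfl⟩
  have hEcoer : ∀ n ≤ N, ‖y n‖ ^ 2 + c * ‖e n‖ ^ 2 ≤ E n := fun n hn => by
    rw [hE]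
    exact add_le_add_right (hcoer (e n) (h.mem_kerV n hn)) _
  have hE0 : ∀ n ≤ N, 0 ≤ E n := fun n hn => le_trans (by positivity) (hEcoer n hn)
  have hEk : ∀ n ≤ N, ‖e n‖ ^ 2 + ‖y n‖ ^ 2 ≤ k * E n := fun n hn => by
    have h1 := hEcoer n hn
    have h2 : ‖e n‖ ^ 2 ≤ 1 / c * E n := by
      rw [one_div, ← div_eq_inv_mul, le_div_iff₀ hc]
      linarith [sq_nonneg ‖y n‖]
    have h3 : ‖y n‖ ^ 2 ≤ E n := by
      have : 0 ≤ c * ‖e n‖ ^ 2 := by positivity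
      linarith
    rw [hk, add_mul]
    linarith
  have hEinit : E 0 ≤ c₀ * τ ^ 4 := by
    have h1 : ‖y 0‖ ^ 2 ≤ (C * τ ^ 2) ^ 2 := by
      have := h.norm_y_zero
      gcongr
    have h2 : A₁ (e 0) (e 0) ≤ ‖A₁‖ * (C * τ ^ 2) * (C * τ ^ 2) := by
      refine (le_abs_self _).trans ((dual_apply_le A₁ _ _).trans ?_)
      have := h.norm_e_zero
      gcongr
    have h3 : κ * ‖J (e 0)‖ ^ 2 ≤ κ * (‖J‖ * (C * τ ^ 2)) ^ 2 := by
      gcongr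
      exact J.le_opNorm_of_le h.norm_e_zero
    have : c₀ * τ ^ 4 = (C * τ ^ 2) ^ 2 + (‖A₁‖ * (C * τ ^ 2) * (C * τ ^ 2)
        + κ * (‖J‖ * (C * τ ^ 2)) ^ 2) := by rw [hc₀]; ring
    rw [this, hE]
    exact add_le_add h1 (add_le_add h2 h3)
  have hrec : ∀ m < n, E (m + 1) - E m ≤ K₀ * k * τ * (E m + E (m + 1) + τ ^ 4) := by
    intro m hmn
    obtain ⟨S, s, ρ, r, hsn, hρ, hr, hst⟩ := h.step m (by omega)
    have h0 := hst.energy_le_of_bounds hA hs hD hτ hτT hκ hL hC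
      (h.lipschitz m (by omega) 1 (hm m (by omega)))
      (h.lipschitz (m + 1) (by omega) 1 (hm _ (by omega))) hsn hρ hr
    rw [← hK₀, ← hE, ← hE] at h0
    refine h0.trans ?_
    rw [mul_right_comm K₀ k, mul_assoc (K₀ * τ)]
    gcongr
    have h1 := hEk m (by omega)
    have h2 := hEk (m + 1) (by omega)
    have h3 : τ ^ 4 ≤ k * τ ^ 4 := le_mul_of_one_le_left (by positivity) hk1
    linarith
  have h1 : E n ≤ Real.exp (4 * (K₀ * k) * T) * (E 0 + τ ^ 4) := by
    refine discrete_gronwall (fun m hm => hE0 m (hm.trans hn)) (by positivity) hτ.le hKτ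
      (by positivity) ?_ hrec
    refine le_trans ?_ hNT
    gcongr
  have h2 : k * E n ≤ (√(k * (Real.exp (4 * (K₀ * k) * T) * (c₀ + 1))) * τ ^ 2) ^ 2 := by
    rw [mul_pow, Real.sq_sqrt (by positivity), mul_assoc, ← pow_mul]
    gcongr
    have h3 : Real.exp (4 * (K₀ * k) * T) * (E 0 + τ ^ 4)
        ≤ Real.exp (4 * (K₀ * k) * T) * ((c₀ + 1) * τ ^ 4) := by
      gcongr
      linarith
    exact h1.trans (h3.trans (le_of_eq (by ring)))
  have h4 := hEk n hn
  have h5 := sq_nonneg ‖y n‖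
  have h6 := sq_nonneg ‖e n‖
  exact ⟨(abs_le_of_sq_le_sq' (by linarith) (by positivity)).2, (abs_le_of_sq_le_sq' (by linarith) (by positivity)).2⟩

/-- Second-order bounds of the errors for small step sizes. -/
lemma IsErrorSeq.exists_bound_of_small
    (hAe : ∃ α : ℝ, 0 < α ∧ ∀ v ∈ kerV B, α * ‖v‖ ^ 2 ≤ A v v)
    (hA : ∀ v φ, A v φ = A₁ v φ + inner ℝ (A₂ v) (J φ)) (hs : ∀ v φ, A₁ v φ = A₁ φ v)
    (hD : ∀ v, 0 ≤ inner ℝ (D₀ v) (J v)) (hC : 0 ≤ C) (hl : ∀ σ, 0 ≤ l σ) (hT : 0 ≤ T) :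
    ∃ τ₀ > 0, ∃ G, 0 ≤ G ∧ ∀ (τ : ℝ) (N : ℕ), 0 < τ → τ ≤ T → τ ≤ τ₀ → N * τ ≤ T →
      ∀ (e : ℕ → V) (y Δ : ℕ → H), IsErrorSeq J A B D₀ C l τ N e y Δ →
        ∀ n ≤ N, ‖e n‖ ≤ G * τ ^ 2 ∧ ‖y n‖ ≤ G * τ ^ 2 := by
  obtain ⟨K, G, hK, hG, hcond⟩ := IsErrorSeq.exists_conditional_bound hAe hA hs hD hC hl hT
  obtain ⟨α, hα, hAe⟩ := hAe
  have hL : 0 ≤ l 1 := hl 1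
  obtain ⟨c, hc⟩ : ∃ c, c = (2 * ‖A‖ + 1) / α + 1 := ⟨_, rfl⟩
  have hc0 : 0 ≤ c := by rw [hc]; positivity
  -- `G₁ * τ ^ 2` bounds `e (n + 1)` by `norm_increment_le` once step `n` satisfies the bounds with
  -- `G`.
  obtain ⟨G₁, hG₁⟩ : ∃ G₁, G₁ = G + c * (G + C * T + (2 * G + T * (l 1 * (G + C))
    + C * T + C * T)) := ⟨_, rfl⟩
  have hG₁0 : 0 ≤ G₁ := by rw [hG₁]; positivity
  -- This threshold yields at once `K * τ ≤ 1 / 2` for Gronwall and `G₁ * τ ^ 2 ≤ 1`, `C * τ ^ 2 ≤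
  -- 1` for the induction.
  refine ⟨1 / (2 * (K + G₁ + C + 1)), by positivity, G, hG, fun τ N hτ hτT hτ₀ hNT e y Δ h => ?_⟩
  have hqτ : (K + G₁ + C + 1) * τ ≤ 1 / 2 := by
    rw [le_div_iff₀ (by positivity)] at hτ₀
    linarith
  have p1 : 0 ≤ K * τ := by positivity
  have p2 : 0 ≤ G₁ * τ := by positivity
  have p3 : 0 ≤ C * τ := by positivity
  have hτ1 : τ ≤ 1 := by linarith
  have hG₁τ : G₁ * τ ^ 2 ≤ 1 := by nlinarith
  have hCτ : C * τ ^ 2 ≤ 1 := by nlinarith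
  have hcond := hcond τ N hτ hτT (by linarith) hNT e y Δ h
  have hbound : ∀ n ≤ N, ∀ m ≤ n, ‖e m‖ ≤ 1 := by
    intro n
    induction n with
    | zero =>
      intro _ m hm
      obtain rfl : m = 0 := by omega
      exact h.norm_e_zero.trans hCτ
    | succ n ih =>
      intro hn m hm
      have ih := ih (by omega)
      rcases Nat.lt_or_eq_of_le hm with hm | rfl
      · exact ih m (by omega)
      obtain ⟨he, hy⟩ := hcond n (by omega) ih
      obtain ⟨S, s, ρ, r, hsn, hρ, hr, hst⟩ := h.step n (by omega)
      have hinc := hst.norm_increment_le hα (hAe _ ((kerV B).sub_mem (h.mem_kerV _ hn)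
        (h.mem_kerV n (by omega)))) hD hτ
      rw [← hc] at hinc
      have hΔ : ‖Δ n‖ ≤ l 1 * (G + C) * τ ^ 2 :=
        (h.lipschitz n (by omega) 1 (ih n le_rfl)).trans (by rw [mul_assoc, add_mul]; gcongr)
      have hτ3 : C * τ ^ 3 ≤ C * T * τ ^ 2 := by
        have : C * τ ^ 2 * τ ≤ C * τ ^ 2 * T := by gcongr
        linarith
      have hτΔ : τ * ‖Δ n‖ ≤ T * (l 1 * (G + C) * τ ^ 2) := by gcongr
      have h1 : ‖e n‖ + ‖r‖ + (2 * ‖y n‖ + τ * ‖Δ n‖ + ‖ρ‖ + ‖s‖)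
          ≤ (G + C * T + (2 * G + T * (l 1 * (G + C)) + C * T + C * T)) * τ ^ 2 := by
        linarith
      have h2 := mul_le_mul_of_nonneg_left h1 hc0
      have h3 := norm_add_le (e n) (e (n + 1) - e n)
      rw [add_sub_cancel] at h3
      rw [hG₁, add_mul, mul_assoc] at hG₁τ
      linarith
  exact fun n hn => hcond n hn (hbound n hn)

/-- Second-order bounds of the errors for all step sizes `T / N`. -/
lemma IsErrorSeq.exists_uniform_bound
    (hAe : ∃ α : ℝ, 0 < α ∧ ∀ v ∈ kerV B, α * ‖v‖ ^ 2 ≤ A v v)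
    (hA : ∀ v φ, A v φ = A₁ v φ + inner ℝ (A₂ v) (J φ)) (hs : ∀ v φ, A₁ v φ = A₁ φ v)
    (hD : ∀ v, 0 ≤ inner ℝ (D₀ v) (J v)) (hC : 0 ≤ C) (hl : ∀ σ, 0 ≤ l σ) (hT : 0 < T) :
    ∃ G, 0 ≤ G ∧ ∀ (N : ℕ) (τ : ℝ), 1 ≤ N → τ = T / N →
      ∀ (e : ℕ → V) (y Δ : ℕ → H), IsErrorSeq J A B D₀ C l τ N e y Δ →
        ∀ n ≤ N, ‖e n‖ ≤ G * τ ^ 2 ∧ ‖y n‖ ≤ G * τ ^ 2 := by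
  obtain ⟨τ₀, hτ₀, G, hG, hsmall⟩ := IsErrorSeq.exists_bound_of_small hAe hA hs hD hC hl hT.le
  have hfix : ∀ N : ℕ, ∃ R, 1 ≤ N → ∀ (e : ℕ → V) (y Δ : ℕ → H),
      IsErrorSeq J A B D₀ C l (T / N) N e y Δ → ∀ n ≤ N, ‖e n‖ ≤ R ∧ ‖y n‖ ≤ R := by
    intro N
    rcases Nat.eq_zero_or_pos N with rfl | hN
    · exact ⟨0, fun h => absurd h (by omega)⟩
    · have hN' : (0 : ℝ) < N := by exact_mod_cast hN
      obtain ⟨R, hR⟩ := IsErrorSeq.exists_bound (A := A) (B := B) hAe hD hl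
        (div_pos hT hN') N
      exact ⟨R, fun _ => hR⟩
  choose R hR using hfix
  obtain ⟨N₀, hN₀⟩ := exists_nat_gt (T / τ₀)
  -- Only indices `N < N₀` can have `T / N > τ₀`; dividing their common bound by `τ₀ ^ 2` makes it a
  -- second-order bound.
  set R₀ := ∑ N ∈ Finset.range N₀, |R N| with hR₀
  have hR₀0 : 0 ≤ R₀ := Finset.sum_nonneg fun _ _ => abs_nonneg _
  refine ⟨G + R₀ / τ₀ ^ 2, by positivity, fun N τ hN hτ e y Δ h n hn => ?_⟩
  have hN' : (0 : ℝ) < N := by exact_mod_cast hN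
  have hτ0 : 0 < τ := hτ ▸ div_pos hT hN'
  rcases le_or_gt τ τ₀ with hle | hgt
  · have h1 := hsmall τ N hτ0 (by rw [hτ]; exact div_le_self hT.le (by exact_mod_cast hN)) hle
      (by rw [hτ, mul_div_cancel₀ _ hN'.ne']) e y Δ h n hn
    have h2 : 0 ≤ R₀ / τ₀ ^ 2 * τ ^ 2 := by positivity
    rw [add_mul]
    exact ⟨by linarith [h1.1], by linarith [h1.2]⟩
  · have hNN : N < N₀ := by
      have : (N : ℝ) < T / τ₀ := by
        rw [lt_div_iff₀ hτ₀]
        rw [hτ, lt_div_iff₀ hN'] at hgt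
        linarith
      exact_mod_cast this.trans hN₀
    have h1 := hR N hN e y Δ (hτ ▸ h) n hn
    have h2 : R N ≤ R₀ := (le_abs_self _).trans
      (Finset.single_le_sum (f := fun k => |R k|) (fun _ _ => abs_nonneg _)
        (Finset.mem_range.2 hNN))
    have h3 : R₀ ≤ R₀ / τ₀ ^ 2 * τ ^ 2 := by
      rw [div_mul_eq_mul_div, le_div_iff₀ (by positivity)]
      gcongr
    have h4 : 0 ≤ G * τ ^ 2 := by positivity
    rw [add_mul]
    exact ⟨by linarith [h1.1], by linarith [h1.2]⟩

end ErrorSequence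

/-! ### The error equations of the scheme and recovery of the full velocity error. -/

section Scheme

variable {V H Q : Type*}
  [NormedAddCommGroup V] [InnerProductSpace ℝ V]
  [NormedAddCommGroup H] [InnerProductSpace ℝ H]
  [NormedAddCommGroup Q] [InnerProductSpace ℝ Q]
  {J : V →L[ℝ] H} {A : V →L[ℝ] StrongDual ℝ V} {B : V →L[ℝ] StrongDual ℝ Q}
  {D : H →L[ℝ] StrongDual ℝ V} {D₀ : V →L[ℝ] H} {f : ℝ → H → H} {g : ℝ → StrongDual ℝ Q} {T : ℝ}

lemma IMEXStep.map_update {τ t : ℝ} {U U' wh : V} {W W' : H} {lm mu : Q}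
    (h : IMEXStep J A B D f g τ t U W wh lm U' W' mu) (hτ : 0 < τ) (hU : B U = g t) :
    B U' = g (t + τ) := by
  rw [h.update, map_add, map_smul, h.half_constraint, smul_inv_smul₀ hτ.ne', hU]
  abel

/-- The scheme satisfies the constraint `B u = g` at all time steps. -/
lemma IsIMEXSequence.map_eq {τ : ℝ} {N : ℕ} {u₀ w₀ : V} {U : ℕ → V} {W : ℕ → H}
    (h : IsIMEXSequence J A B D f g τ N u₀ w₀ U W) (hτ : 0 < τ) (h0 : B u₀ = g 0) :
    ∀ n ≤ N, B (U n) = g (n * τ) := by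
  intro n
  induction n with
  | zero => intro _; simp [h.initial_u, h0]
  | succ n ih =>
    intro hn
    obtain ⟨wh, lm, mu, hst⟩ := h.step n (by omega)
    rw [hst.map_update hτ (ih (by omega))]
    push_cast
    ring_nf

/-- A step of the scheme, tested with `V_ker` and freed of the multipliers. -/
lemma IMEXStep.tested {τ t : ℝ} {U U' wh : V} {W W' : H} {lm mu : Q}
    (h : IMEXStep J A B D f g τ t U W wh lm U' W' mu) (hτ : 0 < τ)
    (hD : ∀ v φ, D (J v) φ = inner ℝ (D₀ v) (J φ)) {φ : V} (hφ : φ ∈ kerV B) :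
    inner ℝ (W' + W - (2 / τ) • J (U' - U) - (τ / 2) • (f (t + τ) (J U') - f t (J U))) (J φ) = 0 ∧
    inner ℝ (W' - W) (J φ) + inner ℝ (D₀ (U' - U)) (J φ) + τ / 2 * A (U + U') φ
      = τ / 2 * inner ℝ (f t (J U) + f (t + τ) (J U')) (J φ) := by
  have h1 := h.half_step φ
  have h2 := h.full_step φ
  have hB : B φ = 0 := hφ
  have hU : U' - U = τ • wh := by rw [h.update]; abel
  have hU' : U + U' = (2 : ℝ) • U + τ • wh := by rw [h.update, two_smul]; abel
  rw [hU, hU']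
  rw [hD] at h1
  simp only [hB, zero_apply, mul_zero, add_zero, inner_add_left, inner_sub_left, map_add,
    map_smul, add_apply, smul_apply, smul_eq_mul, real_inner_smul_left] at h1 h2 ⊢
  have h3 : 2 / τ * (τ * inner ℝ (J wh) (J φ)) = 2 * inner ℝ (J wh) (J φ) := by
    field_simp
  -- The first relation is the full step itself; adding twice the half step eliminates `2 w_half`
  -- and yields the trapezoidal form.
  exact ⟨by rw [h3]; linarith, by linear_combination h2 + 2 * h1⟩

/-- The tested scheme is subtracted from the equations of the corrected solution. As the scheme's
velocity relation is known only against `V_ker`, it is projected onto `H_ker`; the increment of the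
position error lies in `V_ker` and is unaffected. -/
lemma IsCorrection.errorStep [CompleteSpace H] {u a : ℝ → V} {v b : ℝ → H} {C : ℝ} {F : ℝ → H}
    (hc : IsCorrection J A B D₀ F T u v a b C)
    (hD : ∀ v φ, D (J v) φ = inner ℝ (D₀ v) (J φ)) {τ t : ℝ} {U U' wh : V} {W W' : H} {lm mu : Q}
    (h : IMEXStep J A B D f g τ t U W wh lm U' W' mu) (hτ : 0 < τ)
    (ht : t ∈ Icc 0 T) (hs : t + τ ∈ Icc 0 T)
    (he : u t + τ ^ 2 • a t - U ∈ kerV B)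
    (he' : u (t + τ) + τ ^ 2 • a (t + τ) - U' ∈ kerV B) :
    ∃ (S s ρ : H) (r : V),
      ‖s‖ ≤ C * τ ^ 3 ∧ ‖ρ‖ ≤ C * τ ^ 3 ∧ ‖r‖ ≤ C * τ ^ 3 ∧
      ErrorStep J A D₀ τ (u t + τ ^ 2 • a t - U) (u (t + τ) + τ ^ 2 • a (t + τ) - U')
        (projH J B (v t + τ ^ 2 • b t - W)) (projH J B (v (t + τ) + τ ^ 2 • b (t + τ) - W'))
        (F t - f t (J U)) (F (t + τ) - f (t + τ) (J U')) S s ρ r := by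
  obtain ⟨s, ρ, r, hsn, hρ, hr, hs1, hmom⟩ := hc.defect t ht τ hτ hs
  have hδ := (kerV B).sub_mem he' he
  generalize u t + τ ^ 2 • a t = p at *
  generalize u (t + τ) + τ ^ 2 • a (t + τ) = p' at *
  generalize v t + τ ^ 2 • b t = w at *
  generalize v (t + τ) + τ ^ 2 • b (t + τ) = w' at *
  set Δ := F t - f t (J U) with hΔ
  set Δ' := F (t + τ) - f (t + τ) (J U') with hΔ'
  set δ := p' - U' - (p - U) with hδdef
  have hproj : projH J B (w' - W') + projH J B (w - W) - (2 / τ) • J δ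
      = projH J B (s + (τ / 2) • (Δ' - Δ)) := by
    have h0 : projH J B (W' + W - (2 / τ) • J (U' - U)
        - (τ / 2) • (f (t + τ) (J U') - f t (J U))) = 0 :=
      projH_eq_zero fun φ hφ => (h.tested hτ hD hφ).1
    have h1 : (w' - W') + (w - W) - (2 / τ) • J δ = s + (τ / 2) • (Δ' - Δ)
        - (W' + W - (2 / τ) • J (U' - U) - (τ / 2) • (f (t + τ) (J U') - f t (J U))) := by
      rw [← hs1, hΔ, hΔ', hδdef]
      simp only [map_sub]
      module
    have h2 := congrArg (projH J B) h1
    rw [map_sub _ (s + _), h0, sub_zero, map_sub, map_add, map_smul,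
      projH_eq_self (map_mem_kerH hδ)] at h2
    exact h2
  refine ⟨projH J B (s + (τ / 2) • (Δ' - Δ)), s, ρ, r, hsn, hρ, hr, ?_, ?_, ?_, ?_⟩
  · have h1 : τ / 2 * (2 / τ) = 1 := by field_simp
    rw [← hproj, add_comm (projH J B (w' - W')), sub_sub_cancel, smul_smul, h1, one_smul]
  · have h1 := hmom δ hδ
    have h2 := (h.tested hτ hD hδ).2
    have e1 : p' - U' - (p - U) = (p' - p) - (U' - U) := by abel
    have e2 : p - U + (p' - U') = (p + p') - (U + U') := by abel
    rw [← hδdef, ← map_sub, inner_projH J B _ hδ, e2]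
    have e3 : D₀ δ = D₀ (p' - p) - D₀ (U' - U) := by rw [hδdef, e1, map_sub]
    have e4 : w' - W' - (w - W) = (w' - w) - (W' - W) := by abel
    have e5 : Δ + Δ' = (F t + F (t + τ)) - (f t (J U) + f (t + τ) (J U')) := by
      rw [hΔ, hΔ']; abel
    rw [e3, e4, e5, map_sub A, sub_apply, inner_sub_left _ (W' - W), inner_sub_left _ (D₀ _),
      inner_sub_left _ (f t _ + _)]
    linear_combination h1 - h2
  · exact inner_projH J B _ hδ
  · refine (norm_projH_le J B _).trans ((norm_add_le _ _).trans ?_)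
    rw [norm_smul, Real.norm_of_nonneg (by positivity)]
    gcongr
    rw [add_comm]
    exact norm_sub_le _ _

/-- The errors with respect to the corrected exact solution form an error sequence. -/
lemma IsCorrection.isErrorSeq [CompleteSpace H] {u a : ℝ → V} {v b : ℝ → H} {C M : ℝ}
    (hc : IsCorrection J A B D₀ (fun t => f t (J (u t))) T u v a b C)
    (hD : ∀ v φ, D (J v) φ = inner ℝ (D₀ v) (J φ)) (hC : 0 ≤ C)
    (hu : ∀ t ∈ Icc 0 T, ‖u t‖ ≤ M) (hug : ∀ t ∈ Icc 0 T, B (u t) = g t)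
    {ℓ : ℝ → ℝ} (hℓ : ∀ σ, 0 ≤ ℓ σ)
    (hf : ∀ σ, ∀ t ∈ Icc 0 T, ∀ v₁ v₂ : V, ‖v₁‖ ≤ σ → ‖v₂‖ ≤ σ →
      ‖f t (J v₁) - f t (J v₂)‖ ≤ ℓ σ * ‖v₁ - v₂‖)
    {u₀ w₀ : V} (hu₀ : u 0 = u₀) (hw₀ : v 0 = J w₀) {τ : ℝ} {N : ℕ} (hτ : 0 < τ)
    (hτT : τ ≤ T) (hN : N * τ ≤ T) {U : ℕ → V} {W : ℕ → H}
    (h : IsIMEXSequence J A B D f g τ N u₀ w₀ U W) :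
    IsErrorSeq J A B D₀ C (fun σ => ℓ (M + T ^ 2 * C + σ)) τ N
      (fun n => u (n * τ) + τ ^ 2 • a (n * τ) - U n)
      (fun n => projH J B (v (n * τ) + τ ^ 2 • b (n * τ) - W n))
      (fun n => f (n * τ) (J (u (n * τ))) - f (n * τ) (J (U n))) := by
  have htn : ∀ n : ℕ, n ≤ N → (n * τ : ℝ) ∈ Icc 0 T := fun n hn =>
    ⟨by positivity, (by gcongr : (n * τ : ℝ) ≤ N * τ).trans hN⟩
  have hsucc : ∀ n : ℕ, ((n + 1 : ℕ) : ℝ) * τ = n * τ + τ := fun n => by push_cast; ring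
  have h0 : (0 : ℝ) ∈ Icc 0 T := by simpa using htn 0 (by omega)
  have hBU := h.map_eq hτ (by rw [← hu₀, hug 0 h0])
  have hmem : ∀ n ≤ N, u (n * τ) + τ ^ 2 • a (n * τ) - U n ∈ kerV B := fun n hn => by
    have h1 : B (a (n * τ)) = 0 := hc.mem_kerV _
    change B _ = 0
    rw [map_sub, map_add, map_smul, h1, hug _ (htn n hn), hBU n hn]
    simp
  have hτ2 : ‖τ ^ 2‖ = τ ^ 2 := Real.norm_of_nonneg (by positivity)
  refine ⟨hmem, ?_, ?_, fun n hn σ hσ => ?_, fun n hn => ?_⟩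
  · have := (hc.bound 0 h0).1
    simp only [Nat.cast_zero, zero_mul, h.initial_u, hu₀, add_sub_cancel_left, norm_smul, hτ2]
    rw [mul_comm]
    gcongr
  · have := (hc.bound 0 h0).2
    simp only [Nat.cast_zero, zero_mul, h.initial_w, hw₀, add_sub_cancel_left]
    refine (norm_projH_le J B _).trans ?_
    rw [norm_smul, hτ2, mul_comm]
    gcongr
  · have ha := (hc.bound _ (htn n hn)).1
    have hun := hu _ (htn n hn)
    set e := u (n * τ) + τ ^ 2 • a (n * τ) - U n with he
    have haτ : ‖τ ^ 2 • a (n * τ)‖ ≤ C * τ ^ 2 := by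
      rw [norm_smul, hτ2, mul_comm]; gcongr
    have h1 : ‖u (n * τ) - U n‖ ≤ ‖e‖ + C * τ ^ 2 := by
      have : u (n * τ) - U n = e - τ ^ 2 • a (n * τ) := by rw [he]; abel
      rw [this]
      exact (norm_sub_le _ _).trans (add_le_add_right haτ _)
    have hτT : C * τ ^ 2 ≤ T ^ 2 * C := by
      rw [mul_comm]
      gcongr
    have hσ0 : 0 ≤ σ := (norm_nonneg e).trans hσ
    -- The Lipschitz constant of `f` must be taken on a ball containing `U n`, whose radius allows
    -- for the exact solution, the correction and `σ`.
    have hU : ‖U n‖ ≤ M + T ^ 2 * C + σ := by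
      have : U n = u (n * τ) - (u (n * τ) - U n) := by abel
      rw [this]
      refine (norm_sub_le _ _).trans ?_
      linarith
    refine (hf _ _ (htn n hn) _ _ (hun.trans ?_) hU).trans (mul_le_mul_of_nonneg_left h1 (hℓ _))
    have : 0 ≤ T ^ 2 * C := by positivity
    linarith
  · obtain ⟨wh, lm, mu, hst⟩ := h.step n hn
    have h1 := htn n hn.le
    have h2 := htn (n + 1) hn
    have h3 := hmem (n + 1) hn
    rw [hsucc] at h2 h3 ⊢
    exact hc.errorStep hD hst hτ h1 h2 (hmem n hn.le) h3

/-- The component of `W` outside of `H_ker` is determined by the constraint, so that the error is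
controlled by its projection onto `H_ker` and the error of the constraint. -/
lemma ExtendedConstraint.norm_map_sub_le [CompleteSpace H]
    (hA : ∃ α : ℝ, 0 < α ∧ ∀ v ∈ kerV B, α * ‖v‖ ^ 2 ≤ A v v)
    {R : StrongDual ℝ Q →L[ℝ] V} (hR : ∀ q, R q ∈ complV A B ∧ B (R q) = q) {W : H}
    {q : StrongDual ℝ Q} (h : ExtendedConstraint J A B W q) (v : V) :
    ‖J v - W‖ ≤ ‖projH J B (J v - W)‖ + 2 * (‖J‖ * (‖R‖ * ‖B v - q‖)) := by
  obtain ⟨x, hx, c, hc, rfl, hcq⟩ := h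
  -- Uniqueness in `V_c` leaves only the `H_ker` component of `W` free. The sum `H_ker + V_c` need
  -- not be orthogonal in `H`, so the `V_c` error also enters the projection; hence the factor `2`.
  have hcR : c = R q := eq_of_mem_complV hA hc (hR q).1 (by rw [hcq, (hR q).2])
  have hk : v - R (B v) ∈ kerV B := by
    change B (v - R (B v)) = 0
    rw [map_sub, (hR _).2, sub_self]
  set z := J (R (B v - q)) with hz
  have hzn : ‖z‖ ≤ ‖J‖ * (‖R‖ * ‖B v - q‖) := J.le_opNorm_of_le (R.le_opNorm _)
  have hd : J v - (x + J c) = (J (v - R (B v)) - x) + z := by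
    rw [hz, hcR]
    simp only [map_sub]
    abel
  have hp : projH J B (J v - (x + J c)) = (J (v - R (B v)) - x) + projH J B z := by
    rw [hd, map_add, projH_eq_self ((kerH J B).sub_mem (map_mem_kerH hk) hx)]
  have hd' : J v - (x + J c) = projH J B (J v - (x + J c)) - projH J B z + z := by
    rw [hp, hd]; abel
  have h1 := norm_add_le (projH J B (J v - (x + J c)) - projH J B z) z
  rw [← hd'] at h1
  have h2 := norm_sub_le (projH J B (J v - (x + J c))) (projH J B z)
  have h3 := norm_projH_le J B z
  linarith

end Scheme

end ConstrainedWave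

end

/-! ### Assembly of the error bound. -/

theorem mainTheorem2 {V H Q : Type*}
    [NormedAddCommGroup V] [InnerProductSpace ℝ V] [CompleteSpace V]
    [NormedAddCommGroup H] [InnerProductSpace ℝ H] [CompleteSpace H]
    [NormedAddCommGroup Q] [InnerProductSpace ℝ Q] [CompleteSpace Q]
    (J : V →L[ℝ] H) (hJ : ConstrainedWave.IsGelfandTriple J)
    (A : V →L[ℝ] StrongDual ℝ V) (B : V →L[ℝ] StrongDual ℝ Q) (D : H →L[ℝ] StrongDual ℝ V)
    (hB : ConstrainedWave.InfSupCondition B)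
    (hA : ConstrainedWave.DifferentialAssumption J A B)
    (hD : ConstrainedWave.DampingAssumption J D)
    (T : ℝ) (hT : 0 < T)
    (f : ℝ → H → H) (hf : ConstrainedWave.LocallyLipschitzNonlinearity J T f)
    -- the scheme evaluates `g` up to time `T + τ / 2`, where `τ ≤ T`
    (g : ℝ → StrongDual ℝ Q) (hg : ContDiffOn ℝ 4 g (Set.Icc 0 (3 / 2 * T)))
    -- consistent initial data
    (u₀ w₀ u₀ker w₀ker u₀c w₀c : V)
    (hu₀ : u₀ = u₀ker + u₀c)
    (hu₀ker : ConstrainedWave.MemDomainKer J A B u₀ker)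
    (hu₀c : ConstrainedWave.IsRightInverseValue A B (g 0) u₀c)
    (hw₀ : w₀ = w₀ker + w₀c)
    (hw₀ker : w₀ker ∈ ConstrainedWave.kerV B)
    (hw₀c : ConstrainedWave.IsRightInverseValue A B (derivWithin g (Set.Icc 0 T) 0) w₀c)
    -- the exact solution and its regularity
    (u : ℝ → V) (lam : ℝ → Q)
    (hu : ConstrainedWave.IsSolution J A B D f g T u₀ w₀ u lam)
    (huV : ContDiffOn ℝ 3 u (Set.Icc 0 T))
    (huH : ContDiffOn ℝ 4 (fun t => J (u t)) (Set.Icc 0 T))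
    (hfu : ContDiffOn ℝ 2 (fun t => f t (J (u t))) (Set.Icc 0 T)) :
    ∃ C : ℝ, 0 < C ∧ ∀ (N : ℕ) (τ : ℝ), 1 ≤ N → τ = T / N →
      ∀ (U : ℕ → V) (W : ℕ → H),
        ConstrainedWave.IsIMEXSequence J A B D f g τ N u₀ w₀ U W →
        ∀ n ≤ N,
          ‖u (n * τ) - U n‖ + ‖ConstrainedWave.velocity J T u (n * τ) - W n‖ ≤ C * τ ^ 2 := by
  obtain ⟨A₁, A₂, hA₁₂, hA₁⟩ := hA.decomposition
  obtain ⟨D₀, hD₀, hD₀n⟩ := hD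
  obtain ⟨R, hR⟩ := ConstrainedWave.exists_rightInverse_complV hB hA.elliptic
  obtain ⟨du, Mu, hdu0, hdu⟩ := ConstrainedWave.exists_isDerivSeq (n := 3) hT (by exact_mod_cast huV)
  obtain ⟨dx, Mx, hdx0, hdx⟩ := ConstrainedWave.exists_isDerivSeq (n := 4) hT (by exact_mod_cast huH)
  obtain ⟨dF, MF, hdF0, hdF⟩ := ConstrainedWave.exists_isDerivSeq (n := 2) hT (by exact_mod_cast hfu)
  obtain ⟨dg, Mg, hdg0, hdg⟩ := ConstrainedWave.exists_isDerivSeq (n := 4) (show 0 < 3 / 2 * T by positivity)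
    (by exact_mod_cast hg)
  have hdgT : ConstrainedWave.IsDerivSeq 4 dg 0 T Mg := hdg.mono le_rfl (by linarith)
  have h0 : (0 : ℝ) ∈ Icc 0 T := ⟨le_rfl, hT.le⟩
  have hux : ∀ k ≤ 3, ∀ t ∈ Icc 0 T, J (du k t) = dx k t := fun k hk t ht =>
    (hdu.map J).eqOn hT (hdx.mono (by omega) le_rfl)
      (fun t _ => by rw [hdu0, hdx0]) k hk ht
  have hug : ∀ k ≤ 3, ∀ t ∈ Icc 0 T, B (du k t) = dg k t := fun k hk t ht =>
    (hdu.map B).eqOn hT (hdgT.mono (by omega) le_rfl)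
      (fun t ht => by rw [hdu0, hdg0]; exact hu.constraint t ht) k hk ht
  have hvel : ∀ t ∈ Icc 0 T, ConstrainedWave.velocity J T u t = dx 1 t := fun t ht => by
    have := hdx.derivWithin_eq hT (k := 0) (by omega) ht
    rwa [hdx0] at this
  have hacc : ∀ t ∈ Icc 0 T, derivWithin (ConstrainedWave.velocity J T u) (Icc 0 T) t = dx 2 t := fun t ht => by
    rw [derivWithin_congr hvel (hvel t ht)]
    exact hdx.derivWithin_eq hT (k := 1) (by omega) ht
  have hdyn : ∀ t ∈ Icc 0 T, ∀ φ ∈ ConstrainedWave.kerV B,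
      inner ℝ (dx 2 t) (J φ) + inner ℝ (D₀ (du 1 t)) (J φ) + A (du 0 t) φ
        = inner ℝ (dF 0 t) (J φ) := fun t ht φ hφ => by
    have h1 := hu.dynamic t ht φ
    have h2 : B φ = 0 := hφ
    rw [hacc t ht, hvel t ht, ← hux 1 (by omega) t ht, hD₀, h2, zero_apply, add_zero] at h1
    rw [hdu0, hdF0]
    exact h1
  obtain ⟨a, b, C₁, hC₁, hcor⟩ := ConstrainedWave.exists_isCorrection hR hT hdu hdgT hdx hdF hux hug hdyn
  rw [hdF0, hdu0] at hcor
  choose L hL using hf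
  obtain ⟨G, hG, hGbound⟩ := ConstrainedWave.IsErrorSeq.exists_uniform_bound (J := J) (A := A) (B := B)
    (l := fun σ => |L (Mu + T ^ 2 * C₁ + σ)|) hA.elliptic hA₁₂ hA₁ hD₀n hC₁
    (fun _ => abs_nonneg _) hT
  have hMg : 0 ≤ Mg := hdgT.nonneg h0
  refine ⟨2 * G + 2 * C₁ + 2 * (‖J‖ * (‖R‖ * (2 * Mg))) + 1, by positivity,
    fun N τ hN hτ U W h n hn => ?_⟩
  have hN' : (0 : ℝ) < N := by exact_mod_cast hN
  have hτ0 : 0 < τ := hτ ▸ div_pos hT hN'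
  have hNτ : N * τ = T := by rw [hτ, mul_div_cancel₀ _ hN'.ne']
  have hτT : τ ≤ T := by
    rw [← hNτ]
    exact le_mul_of_one_le_left hτ0.le (by exact_mod_cast hN)
  have hseq := hcor.isErrorSeq (M := Mu) (ℓ := fun σ => |L σ|) hD₀ hC₁
    (fun t ht => by rw [← hdu0]; exact hdu.bound 0 (by omega) t ht) hu.constraint
    (fun _ => abs_nonneg _)
    (fun σ t ht v₁ v₂ h1 h2 => (hL σ t ht v₁ v₂ h1 h2).trans (by gcongr; exact le_abs_self _))
    hu.initial_value (by rw [← hvel 0 h0]; exact hu.initial_velocity) hτ0 hτT hNτ.le h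
  obtain ⟨he, hy⟩ := hGbound N τ hN hτ _ _ _ hseq n hn
  have ht : (n * τ : ℝ) ∈ Icc 0 T := ⟨by positivity, by rw [← hNτ]; gcongr⟩
  obtain ⟨ha, hb⟩ := hcor.bound _ ht
  have hτ2 : ‖τ ^ 2‖ = τ ^ 2 := Real.norm_of_nonneg (by positivity)
  have hpos : ‖u (n * τ) - U n‖ ≤ (G + C₁) * τ ^ 2 := by
    have h1 : u (n * τ) - U n = u (n * τ) + τ ^ 2 • a (n * τ) - U n - τ ^ 2 • a (n * τ) := by abel
    rw [h1, add_mul]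
    refine (norm_sub_le _ _).trans (add_le_add he ?_)
    rw [norm_smul, hτ2, mul_comm]
    gcongr
  have hproj : ‖ConstrainedWave.projH J B (dx 1 (n * τ) - W n)‖ ≤ (G + C₁) * τ ^ 2 := by
    have h1 : dx 1 (n * τ) - W n
        = (dx 1 (n * τ) + τ ^ 2 • b (n * τ) - W n) - τ ^ 2 • b (n * τ) := by abel
    rw [h1, map_sub, add_mul]
    refine (norm_sub_le _ _).trans (add_le_add hy ((ConstrainedWave.norm_projH_le J B _).trans ?_))
    rw [norm_smul, hτ2, mul_comm]
    gcongr
  have hvelo : ‖ConstrainedWave.velocity J T u (n * τ) - W n‖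
      ≤ (G + C₁) * τ ^ 2 + 2 * (‖J‖ * (‖R‖ * (2 * Mg * τ ^ 2))) := by
    -- The extended constraint is imposed only by a step of the scheme; at `n = 0` the velocity
    -- error vanishes instead.
    rcases n with _ | n
    · simp only [Nat.cast_zero, zero_mul, h.initial_w, hu.initial_velocity, sub_self, norm_zero]
      positivity
    · obtain ⟨wh, lm, mu, hst⟩ := h.step n (by omega)
      have h1 := hst.full_constraint.norm_map_sub_le hA.elliptic hR (du 1 ((n + 1 : ℕ) * τ))
      rw [hux 1 (by omega) _ ht, hug 1 (by omega) _ ht] at h1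
      rw [hvel _ ht]
      refine h1.trans (add_le_add hproj ?_)
      -- The difference of `g` is centred at the new time, with left node `n τ + τ / 2`. Its right
      -- node is at most `T + τ / 2`, which requires `g` on `[0, 3 T / 2]`.
      have h2 := (hdg.mono (m := 3) (by omega) le_rfl).central_difference (t := n * τ + τ / 2)
        (h := τ) ⟨by positivity, ?_⟩ ⟨by positivity, ?_⟩ hτ0
      · have e1 : n * τ + τ / 2 + τ / 2 = (n + 1 : ℕ) * τ := by push_cast; ring
        have e2 : n * τ + τ / 2 + τ = n * τ + 3 / 2 * τ := by ring
        rw [e1, e2, hdg0] at h2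
        gcongr
      all_goals
        have := ht.2
        push_cast at this
        linarith
  linarith [sq_nonneg τ]
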